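/- All $C^*$-algebras are separable and $\mathbb Z/2$-graded (equipped with a $*$-automorphism $\gamma$ with $\gamma^2=\mathrm{id}$), all $*$-homomorphisms are graded, commutators are graded commutators, and $\hat\otimes$ is the maximal graded tensor product. Let $S=C_0(\mathbb R)$, graded by even and odd functions, and let $\mathcal K$ be the compact operators on $\ell^2\oplus\ell^2$, graded by conjugation with $\mathrm{diag}(1,-1)$. An unbounded self-adjoint multiplier of $B$ is a regular self-adjoint operator $D$ on $B$, viewed as a right Hilbert $B$-module over itself; it is odd if $\gamma D\gamma=-D$; $f\mapsto f(D)\in M(B)$ ($f\in S$) denotes its functional calculus. An asymptotic pair $(\phi,D)$ for $(A,B)$ consists of a strict $*$-homomorphism $\phi:A\to M(B)$ (one sending an approximate unit of $A$ to a strictly Cauchy net) and an odd unbounded self-adjoint multiplier $D$ of $B$ such that, for all $f\in S$, $a\in A$: $f(D)\phi(a)\in B$, and $[f(t^{-1}D),\phi(a)]\to 0$ in norm as $t\to\infty$. Let $[\![X,Y]\!]$ be the set of homotopy classes of asymptotic morphisms $\{\Phi_t\}_{t\in[1,\infty)}:X\to Y$, and let $E(A,B)=[\![S\hat\otimes A,B\hat\otimes\mathcal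 K]\!]$. If $B$ is stable, with a graded isomorphism $\theta:B\cong B\hat\otimes\mathcal K$, then the class of $(\phi,D)$ in $E(A,B)$ is the class of $\theta\circ\Phi_t$, where $\Phi_t:S\hat\otimes A\to B$ is an asymptotic morphism, determined up to asymptotic equivalence by $\Phi_t(f\hat\otimes a)-f(t^{-1}D)\phi(a)\to 0$ for all $f\in S$, $a\in A$. Let $E'(A,B)\subseteq E(A,B)$ be the set of classes of asymptotic pairs. **Lemma.** Let $A,B$ be graded $C^*$-algebras with $B$ stable, with a graded isomorphism $\theta:B\cong B\hat\otimes\mathcal K$, let $\phi:A\to B$ be a $*$-homomorphism (into $B$ itself, and not just into $M(B)$), and let $D$ be an odd unbounded self-adjoint multiplier of $B$ such that $(\phi,D)$ is an asymptotic pair. Then $(\phi,0)$ is an asymptotic pair, the classes of $(\phi,D)$ and $(\phi,0)$ are well defined, and they are equal in $E'(A,B)$. -/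

import Mathlib

open Filter Topology MultiplierAlgebra ZeroAtInfty TensorProduct

noncomputable section

namespace ETh

/-! ### Graded C*-algebras -/

/-- A `ℤ/2`-grading of a C*-algebra: a `*`-automorphism `γ` with `γ² = id`. -/
class Grading (A : Type*) [NonUnitalCStarAlgebra A] where
  γ : A ≃⋆ₐ[ℂ] A
  γ_γ : ∀ a, γ (γ a) = a

attribute [simp] Grading.γ_γ

/-- A map between graded C*-algebras is graded if it intertwines the gradings. -/
def IsGraded {A B : Type*} [NonUnitalCStarAlgebra A] [Grading A] [NonUnitalCStarAlgebra B]
    [Grading B] (F : A → B) : Prop :=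
  ∀ a, F (Grading.γ a) = Grading.γ (F a)

section parts

variable {A : Type*} [NonUnitalCStarAlgebra A] [Grading A]

lemma norm_γ (a : A) : ‖Grading.γ a‖ = ‖a‖ := by
  have h : ∀ x : A, ‖Grading.γ x‖ ≤ ‖x‖ := fun x =>
    NonUnitalStarAlgHom.norm_apply_le (Grading.γ : A ≃⋆ₐ[ℂ] A) x
  refine le_antisymm (h a) ?_
  simpa using h (Grading.γ a)

variable (A) in
/-- The grading automorphism as a continuous linear map. -/
def γL : A →L[ℂ] A :=
  LinearMap.mkContinuous
    { toFun := fun a => Grading.γ a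
      map_add' := fun a b => map_add _ a b
      map_smul' := fun c a => map_smul _ c a } 1 (fun a => by simp [norm_γ])

@[simp] lemma γL_apply (a : A) : γL A a = Grading.γ a := rfl

variable (A) in
/-- The projection `a ↦ (a + γ a) / 2` onto the even part. -/
def evenPart : A →ₗ[ℂ] A := (2⁻¹ : ℂ) • (LinearMap.id + (γL A : A →ₗ[ℂ] A))

variable (A) in
/-- The projection `a ↦ (a - γ a) / 2` onto the odd part. -/
def oddPart : A →ₗ[ℂ] A := (2⁻¹ : ℂ) • (LinearMap.id - (γL A : A →ₗ[ℂ] A))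

lemma evenPart_apply (a : A) : evenPart A a = (2⁻¹ : ℂ) • (a + Grading.γ a) := rfl

lemma oddPart_apply (a : A) : oddPart A a = (2⁻¹ : ℂ) • (a - Grading.γ a) := rfl

lemma even_add_odd (a : A) : evenPart A a + oddPart A a = a := by
  rw [evenPart_apply, oddPart_apply]; module

lemma γ_even (a : A) : Grading.γ (evenPart A a) = evenPart A a := by
  rw [evenPart_apply, map_smul, map_add, Grading.γ_γ, add_comm]

lemma γ_odd (a : A) : Grading.γ (oddPart A a) = - oddPart A a := by
  rw [oddPart_apply, map_smul, map_sub, Grading.γ_γ]; module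

lemma evenPart_of_even {a : A} (h : Grading.γ a = a) : evenPart A a = a := by
  rw [evenPart_apply, h]; module
lemma oddPart_of_even {a : A} (h : Grading.γ a = a) : oddPart A a = 0 := by
  rw [oddPart_apply, h]; module
lemma evenPart_of_odd {a : A} (h : Grading.γ a = -a) : evenPart A a = 0 := by
  rw [evenPart_apply, h]; module
lemma oddPart_of_odd {a : A} (h : Grading.γ a = -a) : oddPart A a = a := by
  rw [oddPart_apply, h]; module

/-- The graded commutator: the bilinear extension of `[x, y] = x y - (-1)^(∂x ∂y) y x` from
homogeneous elements, so that `[x, y] = x y - y x` for `y` even and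
`[x, y] = x y - y γ(x)` for `y` odd. -/
def gradedCommutator (x y : A) : A :=
  x * y - (evenPart A y * x + oddPart A y * Grading.γ x)

end parts

/-! ### Examples of gradings -/

/-- `S = C₀(ℝ)`, graded into even and odd functions. -/
abbrev S : Type := C₀(ℝ, ℂ)

/-- Reflection `f ↦ (x ↦ f (-x))` on `C₀(ℝ)`. -/
def reflect (f : S) : S where
  toFun x := f (-x)
  continuous_toFun := by fun_prop
  zero_at_infty' := (zero_at_infty f).comp (Homeomorph.neg ℝ).isClosedEmbedding.tendsto_cocompact

@[simp] lemma reflect_apply (f : S) (x : ℝ) : reflect f x = f (-x) := rfl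

instance : Grading S where
  γ :=
    { toFun := reflect
      invFun := reflect
      left_inv := fun f => by ext x; simp
      right_inv := fun f => by ext x; simp
      map_mul' := fun f g => by ext x; simp
      map_add' := fun f g => by ext x; simp
      map_star' := fun f => by ext x; simp
      map_smul' := fun c f => by ext x; simp }
  γ_γ := fun f => by ext x; change f (- -x) = f x; simp

/-- `C(X, A)` is graded pointwise. -/
instance {X A : Type*} [TopologicalSpace X] [CompactSpace X] [NonUnitalCStarAlgebra A]
    [Grading A] : Grading C(X, A) where
  γ :=
    { toFun := fun f => (⟨γL A, (γL A).continuous⟩ : C(A, A)).comp f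
      invFun := fun f => (⟨γL A, (γL A).continuous⟩ : C(A, A)).comp f
      left_inv := fun f => by ext x; simp
      right_inv := fun f => by ext x; simp
      map_mul' := fun f g => by ext x; simp
      map_add' := fun f g => by ext x; simp
      map_star' := fun f => by ext x; simp [map_star]
      map_smul' := fun c f => by ext x; simp }
  γ_γ := fun f => by ext x; change Grading.γ (Grading.γ (f x)) = f x; simp

/-- The grading `T ↦ γ ∘ T ∘ γ` of `M(A)`. -/
def multiplierγ {A : Type*} [NonUnitalCStarAlgebra A] [Grading A] (T : 𝓜(ℂ, A)) : 𝓜(ℂ, A) where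
  fst := (γL A).comp (T.fst.comp (γL A))
  snd := (γL A).comp (T.snd.comp (γL A))
  central := fun x y => by
    have := congrArg Grading.γ (T.central (Grading.γ x) (Grading.γ y))
    simpa [map_mul] using this

instance {A : Type*} [NonUnitalCStarAlgebra A] [Grading A] : Grading 𝓜(ℂ, A) where
  γ :=
    { toFun := multiplierγ
      invFun := multiplierγ
      left_inv := fun T => by ext x <;> simp [multiplierγ]
      right_inv := fun T => by ext x <;> simp [multiplierγ]
      map_mul' := fun T U => by ext x <;> simp [multiplierγ]
      map_add' := fun T U => by ext x <;> simp [multiplierγ]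
      map_star' := fun T => by ext x <;> simp [multiplierγ, map_star]
      map_smul' := fun c T => by ext x <;> simp [multiplierγ] }
  γ_γ := fun T => by
    change multiplierγ (multiplierγ T) = T
    ext x <;> simp [multiplierγ]

/-- The standard graded Hilbert space `ℓ² ⊕ ℓ²`, both summands infinite dimensional; the first one
even and the second one odd. -/
abbrev stdHilbert : Type := WithLp 2 (lp (fun _ : ℕ => ℂ) 2 × lp (fun _ : ℕ => ℂ) 2)

/-- The grading unitary `diag(1, -1)`. -/
def stdUnitary : stdHilbert ≃ₗᵢ[ℂ] stdHilbert :=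
  LinearIsometryEquiv.withLpProdCongr 2 (LinearIsometryEquiv.refl ℂ _) (LinearIsometryEquiv.neg ℂ)

/-- The C*-algebra `𝒦` of compact operators: the closure of the algebra of finite rank operators. -/
def compactOps : NonUnitalStarSubalgebra ℂ (stdHilbert →L[ℂ] stdHilbert) :=
  (NonUnitalStarAlgebra.adjoin ℂ
    {T : stdHilbert →L[ℂ] stdHilbert | ∃ x y, T = InnerProductSpace.rankOne ℂ x y}).topologicalClosure

/-- The C*-algebra of compact operators, as a type. -/
def K : Type := compactOps

instance : IsClosed (compactOps : Set (stdHilbert →L[ℂ] stdHilbert)) :=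
  NonUnitalStarSubalgebra.isClosed_topologicalClosure _

instance : NonUnitalCStarAlgebra K := inferInstanceAs (NonUnitalCStarAlgebra compactOps)

lemma conj_mem_compactOps {T : stdHilbert →L[ℂ] stdHilbert} (hT : T ∈ compactOps) :
    stdUnitary.conjStarAlgEquiv T ∈ compactOps := by
  set F := stdUnitary.conjStarAlgEquiv
  have hF : Continuous F := by
    exact AddMonoidHomClass.continuous_of_bound F 1 fun a => by
      rw [one_mul]
      exact NonUnitalStarAlgHom.norm_apply_le F a
  have hle : NonUnitalStarAlgebra.adjoin ℂ
      {T : stdHilbert →L[ℂ] stdHilbert | ∃ x y, T = InnerProductSpace.rankOne ℂ x y} ≤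
      compactOps.comap (F : (stdHilbert →L[ℂ] stdHilbert) →⋆ₙₐ[ℂ] (stdHilbert →L[ℂ] stdHilbert)) := by
    refine NonUnitalStarAlgebra.adjoin_le ?_
    rintro _ ⟨x, y, rfl⟩
    refine NonUnitalStarSubalgebra.le_topologicalClosure _
      (NonUnitalStarAlgebra.subset_adjoin ℂ _ ⟨stdUnitary x, stdUnitary y, ?_⟩)
    ext1 z
    change stdUnitary (inner ℂ y (stdUnitary.symm z) • x) = inner ℂ (stdUnitary y) z • stdUnitary x
    rw [map_smul, ← LinearIsometryEquiv.inner_map_map stdUnitary, LinearIsometryEquiv.apply_symm_apply]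
  have hcl : IsClosed (F ⁻¹' (compactOps : Set (stdHilbert →L[ℂ] stdHilbert))) :=
    IsClosed.preimage hF inferInstance
  exact closure_minimal hle hcl hT

lemma stdUnitary_stdUnitary (x : stdHilbert) : stdUnitary (stdUnitary x) = x := by
  simp [stdUnitary]
  rfl

lemma conj_conj (T : stdHilbert →L[ℂ] stdHilbert) :
    stdUnitary.conjStarAlgEquiv (stdUnitary.conjStarAlgEquiv T) = T := by
  have h : ∀ x, stdUnitary.symm x = stdUnitary x := fun x => by
    rw [LinearIsometryEquiv.symm_apply_eq, stdUnitary_stdUnitary]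
  ext1 x
  simp [h, stdUnitary_stdUnitary]

/-- Conjugation by `diag(1, -1)` on the compact operators. -/
def conjK (T : K) : K := ⟨stdUnitary.conjStarAlgEquiv T.1, conj_mem_compactOps T.2⟩

/-- `𝒦` is graded by conjugation with `diag(1, -1)`. -/
instance : Grading K where
  γ :=
    { toFun := conjK
      invFun := conjK
      left_inv := fun T => Subtype.ext (conj_conj T.1)
      right_inv := fun T => Subtype.ext (conj_conj T.1)
      map_mul' := fun T U => Subtype.ext (map_mul stdUnitary.conjStarAlgEquiv T.1 U.1)
      map_add' := fun T U => Subtype.ext (map_add stdUnitary.conjStarAlgEquiv T.1 U.1)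
      map_star' := fun T => Subtype.ext (map_star stdUnitary.conjStarAlgEquiv T.1)
      map_smul' := fun c T => Subtype.ext (map_smul stdUnitary.conjStarAlgEquiv c T.1) }
  γ_γ := fun T => Subtype.ext (conj_conj T.1)

/-! ### The algebraic graded tensor product -/

/-- The algebraic graded tensor product `A ⊙̂ B`. As a vector space it is `A ⊗ B`; the product and
involution carry the Koszul signs. -/
def AlgTensor (A B : Type*) [NonUnitalCStarAlgebra A] [NonUnitalCStarAlgebra B] : Type _ :=
  A ⊗[ℂ] B

namespace AlgTensor

section basic

variable {A B : Type*} [NonUnitalCStarAlgebra A] [NonUnitalCStarAlgebra B]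

instance : AddCommGroup (AlgTensor A B) := inferInstanceAs (AddCommGroup (A ⊗[ℂ] B))
instance : Module ℂ (AlgTensor A B) := inferInstanceAs (Module ℂ (A ⊗[ℂ] B))

/-- Elementary tensors. -/
def tmul (a : A) (b : B) : AlgTensor A B := a ⊗ₜ[ℂ] b

end basic

variable {A B : Type*} [NonUnitalCStarAlgebra A] [Grading A] [NonUnitalCStarAlgebra B] [Grading B]

lemma induction' {A B : Type*} [NonUnitalCStarAlgebra A] [NonUnitalCStarAlgebra B]
    {p : AlgTensor A B → Prop} (x : AlgTensor A B) (h0 : p 0) (ht : ∀ (a : A) (b : B), p (tmul a b))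
    (ha : ∀ x y, p x → p y → p (x + y)) : p x :=
  TensorProduct.induction_on (motive := p) x h0 ht ha

lemma tmul_add {A B : Type*} [NonUnitalCStarAlgebra A] [NonUnitalCStarAlgebra B] (a : A) (b c : B) : tmul a (b + c) = tmul a b + tmul a c :=
  TensorProduct.tmul_add a b c

/-- Induction on elementary tensors with homogeneous second factor. -/
lemma induction {A B : Type*} [NonUnitalCStarAlgebra A] [NonUnitalCStarAlgebra B] [Grading B]
    {p : AlgTensor A B → Prop} (x : AlgTensor A B) (h0 : p 0)
    (he : ∀ (a : A) (b : B), Grading.γ b = b → p (tmul a b))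
    (ho : ∀ (a : A) (b : B), Grading.γ b = -b → p (tmul a b))
    (ha : ∀ x y, p x → p y → p (x + y)) : p x := by
  refine TensorProduct.induction_on (motive := p) x h0 (fun a b => ?_) ha
  have := ha _ _ (he a _ (γ_even b)) (ho a _ (γ_odd b))
  rwa [← tmul_add, even_add_odd] at this

variable (A B) in
/-- The product, as a bilinear map:
`(a ⊗ b)(a' ⊗ b') = a a' ⊗ b₀ b' + a γ(a') ⊗ b₁ b'`, where `b₀`, `b₁` are the even and odd parts
of `b`. On homogeneous elements this is `(-1)^(∂b ∂a') a a' ⊗ b b'`. -/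
def mulMap : A ⊗[ℂ] B →ₗ[ℂ] A ⊗[ℂ] B →ₗ[ℂ] A ⊗[ℂ] B :=
  (LinearMap.mul ℂ (A ⊗[ℂ] B)).comp (TensorProduct.map LinearMap.id (evenPart B)) +
  (LinearMap.mul ℂ (A ⊗[ℂ] B)).compl₁₂ (TensorProduct.map LinearMap.id (oddPart B))
    (TensorProduct.map (γL A : A →ₗ[ℂ] A) LinearMap.id)

variable (A B) in
/-- The involution: `(a ⊗ b)* = a* ⊗ b₀* + γ(a)* ⊗ b₁*`. On homogeneous elements this is
`(-1)^(∂a ∂b) a* ⊗ b*`. -/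
def starMap (x : A ⊗[ℂ] B) : A ⊗[ℂ] B :=
  star (TensorProduct.map LinearMap.id (evenPart B) x) +
  star (TensorProduct.map (γL A : A →ₗ[ℂ] A) (oddPart B) x)

lemma starMap_add (x y : A ⊗[ℂ] B) : starMap A B (x + y) = starMap A B x + starMap A B y := by
  simp only [starMap, map_add, star_add]
  exact add_add_add_comm _ _ _ _

lemma starMap_smul (c : ℂ) (x : A ⊗[ℂ] B) : starMap A B (c • x) = star c • starMap A B x := by
  simp only [starMap, map_smul, star_smul, smul_add]

lemma starMap_zero : starMap A B (0 : A ⊗[ℂ] B) = 0 := by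
  simp only [starMap, map_zero, star_zero, add_zero]

instance : Mul (AlgTensor A B) := ⟨fun x y => mulMap A B x y⟩
instance : Star (AlgTensor A B) := ⟨starMap A B⟩

lemma mul_def (x y : AlgTensor A B) : x * y = mulMap A B x y := rfl

lemma tmul_mul_tmul (a a' : A) (b b' : B) :
    tmul a b * tmul a' b' = tmul (a * a') (evenPart B b * b')
      + tmul (a * Grading.γ a') (oddPart B b * b') := by
  change mulMap A B (a ⊗ₜ b) (a' ⊗ₜ b') = (_ ⊗ₜ _ + _ ⊗ₜ _ : A ⊗[ℂ] B)
  simp [mulMap]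
  rfl

lemma star_tmul (a : A) (b : B) :
    star (tmul a b) = tmul (star a) (star (evenPart B b))
      + tmul (star (Grading.γ a)) (star (oddPart B b)) := rfl

lemma tmul_zero {A B : Type*} [NonUnitalCStarAlgebra A] [NonUnitalCStarAlgebra B] (a : A) : tmul a (0 : B) = 0 := TensorProduct.tmul_zero _ _

lemma tmul_neg {A B : Type*} [NonUnitalCStarAlgebra A] [NonUnitalCStarAlgebra B] (a : A) (b : B) : tmul a (-b) = - tmul a b := TensorProduct.tmul_neg _ _

lemma mul_of_even (a a' : A) {b : B} (b' : B) (h : Grading.γ b = b) :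
    tmul a b * tmul a' b' = tmul (a * a') (b * b') := by
  rw [tmul_mul_tmul, evenPart_of_even h, oddPart_of_even h, zero_mul, tmul_zero, add_zero]

lemma mul_of_odd (a a' : A) {b : B} (b' : B) (h : Grading.γ b = -b) :
    tmul a b * tmul a' b' = tmul (a * Grading.γ a') (b * b') := by
  rw [tmul_mul_tmul, evenPart_of_odd h, oddPart_of_odd h, zero_mul, tmul_zero, zero_add]

lemma star_of_even (a : A) {b : B} (h : Grading.γ b = b) :
    star (tmul a b) = tmul (star a) (star b) := by
  rw [star_tmul, evenPart_of_even h, oddPart_of_even h, star_zero, tmul_zero, add_zero]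

lemma star_of_odd (a : A) {b : B} (h : Grading.γ b = -b) :
    star (tmul a b) = tmul (star (Grading.γ a)) (star b) := by
  rw [star_tmul, evenPart_of_odd h, oddPart_of_odd h, star_zero, tmul_zero, zero_add]

lemma ee {b c : B} (hb : Grading.γ b = b) (hc : Grading.γ c = c) :
    Grading.γ (b * c) = b * c := by rw [map_mul, hb, hc]
lemma eo {b c : B} (hb : Grading.γ b = b) (hc : Grading.γ c = -c) :
    Grading.γ (b * c) = -(b * c) := by rw [map_mul, hb, hc, mul_neg]
lemma oe {b c : B} (hb : Grading.γ b = -b) (hc : Grading.γ c = c) :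
    Grading.γ (b * c) = -(b * c) := by rw [map_mul, hb, hc, neg_mul]
lemma oo {b c : B} (hb : Grading.γ b = -b) (hc : Grading.γ c = -c) :
    Grading.γ (b * c) = b * c := by rw [map_mul, hb, hc, neg_mul_neg]
lemma se {b : B} (hb : Grading.γ b = b) : Grading.γ (star b) = star b := by rw [map_star, hb]
lemma so {b : B} (hb : Grading.γ b = -b) : Grading.γ (star b) = -star b := by
  rw [map_star, hb, star_neg]

instance : NonUnitalNonAssocRing (AlgTensor A B) where
  left_distrib x y z := map_add (mulMap A B x) y z
  right_distrib x y z := LinearMap.map_add₂ (mulMap A B) x y z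
  zero_mul x := LinearMap.map_zero₂ (mulMap A B) x
  mul_zero x := map_zero (mulMap A B x)

instance : NonUnitalRing (AlgTensor A B) where
  mul_assoc x y z := by
    induction x using induction with
    | h0 => simp only [zero_mul]
    | ha x x' h h' => simp only [add_mul, h, h']
    | he a b hb =>
      induction y using induction with
      | h0 => simp only [zero_mul, mul_zero]
      | ha x x' h h' => simp only [add_mul, mul_add, h, h']
      | he a' b' hb' =>
        induction z using induction' with
        | h0 => simp only [mul_zero]
        | ha x y h h' => simp only [mul_add, h, h']
        | ht a'' b'' =>
          rw [mul_of_even _ _ _ hb, mul_of_even _ _ _ (ee hb hb'), mul_of_even _ _ _ hb',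
            mul_of_even _ _ _ hb, mul_assoc, mul_assoc]
      | ho a' b' hb' =>
        induction z using induction' with
        | h0 => simp only [mul_zero]
        | ha x y h h' => simp only [mul_add, h, h']
        | ht a'' b'' =>
          rw [mul_of_even _ _ _ hb, mul_of_odd _ _ _ (eo hb hb'), mul_of_odd _ _ _ hb',
            mul_of_even _ _ _ hb, mul_assoc, mul_assoc]
    | ho a b hb =>
      induction y using induction with
      | h0 => simp only [zero_mul, mul_zero]
      | ha x x' h h' => simp only [add_mul, mul_add, h, h']
      | he a' b' hb' =>
        induction z using induction' with
        | h0 => simp only [mul_zero]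
        | ha x y h h' => simp only [mul_add, h, h']
        | ht a'' b'' =>
          rw [mul_of_odd _ _ _ hb, mul_of_odd _ _ _ (oe hb hb'), mul_of_even _ _ _ hb',
            mul_of_odd _ _ _ hb, map_mul, mul_assoc, mul_assoc]
      | ho a' b' hb' =>
        induction z using induction' with
        | h0 => simp only [mul_zero]
        | ha x y h h' => simp only [mul_add, h, h']
        | ht a'' b'' =>
          rw [mul_of_odd _ _ _ hb, mul_of_even _ _ _ (oo hb hb'), mul_of_odd _ _ _ hb',
            mul_of_odd _ _ _ hb, map_mul, Grading.γ_γ, mul_assoc, mul_assoc]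

instance : SMulCommClass ℂ (AlgTensor A B) (AlgTensor A B) where
  smul_comm c x y := (map_smul (mulMap A B x) c y).symm

instance : IsScalarTower ℂ (AlgTensor A B) (AlgTensor A B) where
  smul_assoc c x y := LinearMap.map_smul₂ (mulMap A B) c x y

instance : StarRing (AlgTensor A B) where
  star_add x y := starMap_add x y
  star_involutive x := by
    have hadd : ∀ x y : AlgTensor A B, star (x + y) = star x + star y := starMap_add
    have hz : star (0 : AlgTensor A B) = 0 := starMap_zero
    induction x using induction with
    | h0 => rw [hz, hz]
    | ha x x' h h' => rw [hadd, hadd, h, h']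
    | he a b hb => rw [star_of_even _ hb, star_of_even _ (se hb), star_star, star_star]
    | ho a b hb =>
      rw [star_of_odd _ hb, star_of_odd _ (so hb), map_star, Grading.γ_γ, star_star, star_star]
  star_mul x y := by
    have hadd : ∀ x y : AlgTensor A B, star (x + y) = star x + star y := starMap_add
    have hz : star (0 : AlgTensor A B) = 0 := starMap_zero
    induction x using induction with
    | h0 => simp only [zero_mul, mul_zero, hz]
    | ha x x' h h' => simp only [add_mul, mul_add, h, h', hadd]
    | he a b hb =>
      induction y using induction with
      | h0 => simp only [zero_mul, mul_zero, hz]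
      | ha x x' h h' => simp only [add_mul, mul_add, h, h', hadd]
      | he a' b' hb' =>
        rw [mul_of_even _ _ _ hb, star_of_even _ (ee hb hb'), star_of_even _ hb',
          star_of_even _ hb, mul_of_even _ _ _ (se hb'), star_mul, star_mul]
      | ho a' b' hb' =>
        rw [mul_of_even _ _ _ hb, star_of_odd _ (eo hb hb'), star_of_odd _ hb',
          star_of_even _ hb, mul_of_odd _ _ _ (so hb'), map_mul, star_mul, star_mul, map_star]
    | ho a b hb =>
      induction y using induction with
      | h0 => simp only [zero_mul, mul_zero, hz]
      | ha x x' h h' => simp only [add_mul, mul_add, h, h', hadd]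
      | he a' b' hb' =>
        rw [mul_of_odd _ _ _ hb, star_of_odd _ (oe hb hb'), star_of_even _ hb',
          star_of_odd _ hb, mul_of_even _ _ _ (se hb'), map_mul, Grading.γ_γ, star_mul, star_mul]
      | ho a' b' hb' =>
        rw [mul_of_odd _ _ _ hb, star_of_even _ (oo hb hb'), star_of_odd _ hb',
          star_of_odd _ hb, mul_of_odd _ _ _ (so hb'), star_mul, star_mul, map_star Grading.γ (Grading.γ a),
          Grading.γ_γ]

instance : StarModule ℂ (AlgTensor A B) where
  star_smul c x := starMap_smul c x

variable (A B) in
/-- The grading `γ ⊗ γ`. -/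
def γMap : AlgTensor A B →ₗ[ℂ] AlgTensor A B :=
  TensorProduct.map (γL A : A →ₗ[ℂ] A) (γL B : B →ₗ[ℂ] B)

lemma γMap_tmul (a : A) (b : B) : γMap A B (tmul a b) = tmul (Grading.γ a) (Grading.γ b) := rfl

lemma γMap_γMap (x : AlgTensor A B) : γMap A B (γMap A B x) = x := by
  induction x using induction with
  | h0 => simp
  | ha x x' h h' => simp only [map_add, h, h']
  | he a b hb => simp [γMap_tmul]
  | ho a b hb => simp [γMap_tmul]

lemma γMap_mul (x y : AlgTensor A B) : γMap A B (x * y) = γMap A B x * γMap A B y := by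
  induction x using induction with
  | h0 => simp
  | ha x x' h h' => simp only [map_add, add_mul, h, h']
  | he a b hb =>
    induction y using induction' with
    | h0 => simp only [mul_zero, map_zero]
    | ha x y h h' => simp only [mul_add, map_add, h, h']
    | ht a' b' =>
      rw [mul_of_even _ _ _ hb, γMap_tmul, γMap_tmul, γMap_tmul,
        mul_of_even _ _ _ (congrArg _ hb), map_mul, map_mul]
  | ho a b hb =>
    induction y using induction' with
    | h0 => simp only [mul_zero, map_zero]
    | ha x y h h' => simp only [mul_add, map_add, h, h']
    | ht a' b' =>
      rw [mul_of_odd _ _ _ hb, γMap_tmul, γMap_tmul, γMap_tmul,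
        mul_of_odd _ _ _ (by rw [hb, map_neg, hb]), map_mul, map_mul]

lemma γMap_star (x : AlgTensor A B) : γMap A B (star x) = star (γMap A B x) := by
  induction x using induction with
  | h0 => simp
  | ha x x' h h' => simp only [map_add, star_add, h, h']
  | he a b hb =>
    rw [star_of_even _ hb, γMap_tmul, γMap_tmul, star_of_even _ (congrArg _ hb), map_star, map_star]
  | ho a b hb =>
    rw [star_of_odd _ hb, γMap_tmul, γMap_tmul, star_of_odd _ (by rw [hb, map_neg, hb]), map_star,
      map_star]

end AlgTensor

/-! ### The maximal graded tensor product -/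

namespace AlgTensor

variable {A B : Type*} [NonUnitalCStarAlgebra A] [Grading A] [NonUnitalCStarAlgebra B] [Grading B]

/-- C*-seminorms on the graded algebraic tensor product. The bound `p (a ⊗ b) ≤ ‖a‖ ‖b‖`
is automatic for C*-seminorms; it is recorded here because it makes the supremum below visibly
finite. -/
structure IsCStarSeminorm (p : Seminorm ℂ (AlgTensor A B)) : Prop where
  mul_le : ∀ x y, p (x * y) ≤ p x * p y
  star_mul_self : ∀ x, p (star x * x) = p x ^ 2
  tmul_le : ∀ a b, p (tmul a b) ≤ ‖a‖ * ‖b‖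

lemma IsCStarSeminorm.zero : IsCStarSeminorm (0 : Seminorm ℂ (AlgTensor A B)) where
  mul_le x y := by simp
  star_mul_self x := by simp
  tmul_le a b := by simp only [zero_apply]; positivity

lemma IsCStarSeminorm.star_le {p : Seminorm ℂ (AlgTensor A B)} (hp : IsCStarSeminorm p)
    (x : AlgTensor A B) : p x ≤ p (star x) := by
  have h := hp.mul_le (star x) x
  rw [hp.star_mul_self] at h
  rcases (apply_nonneg p x).eq_or_lt with h0 | h0
  · rw [← h0]; exact apply_nonneg _ _
  · nlinarith

variable (A B) in
/-- The index type of all C*-seminorms. -/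
abbrev CStarSeminorms : Type _ := {p : Seminorm ℂ (AlgTensor A B) // IsCStarSeminorm p}

instance : Nonempty (CStarSeminorms A B) := ⟨⟨0, .zero⟩⟩

lemma bddAbove (x : AlgTensor A B) :
    BddAbove (Set.range fun p : CStarSeminorms A B => p.1 x) := by
  induction x using induction' with
  | h0 => exact ⟨0, by rintro _ ⟨p, rfl⟩; simp⟩
  | ht a b => exact ⟨‖a‖ * ‖b‖, by rintro _ ⟨p, rfl⟩; exact p.2.tmul_le a b⟩
  | ha x y hx hy =>
    obtain ⟨C, hC⟩ := hx
    obtain ⟨C', hC'⟩ := hy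
    refine ⟨C + C', ?_⟩
    rintro _ ⟨p, rfl⟩
    exact (map_add_le_add p.1 x y).trans (add_le_add (hC ⟨p, rfl⟩) (hC' ⟨p, rfl⟩))

lemma le_sup (p : CStarSeminorms A B) (x : AlgTensor A B) :
    p.1 x ≤ ⨆ q : CStarSeminorms A B, q.1 x := le_ciSup (bddAbove x) p

lemma sup_nonneg (x : AlgTensor A B) : 0 ≤ ⨆ q : CStarSeminorms A B, q.1 x :=
  Real.iSup_nonneg fun q => apply_nonneg q.1 x

variable (A B) in
/-- The maximal C*-seminorm: the supremum of all C*-seminorms. -/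
def maxNorm : Seminorm ℂ (AlgTensor A B) :=
  Seminorm.ofSMulLE (fun x => ⨆ p : CStarSeminorms A B, p.1 x) (by simp)
    (fun x y => ciSup_le fun p =>
      (map_add_le_add p.1 x y).trans (add_le_add (le_sup p x) (le_sup p y)))
    (fun c x => ciSup_le fun p => by
      rw [map_smul_eq_mul]
      exact mul_le_mul_of_nonneg_left (le_sup p x) (norm_nonneg c))

lemma maxNorm_apply (x : AlgTensor A B) : maxNorm A B x = ⨆ p : CStarSeminorms A B, p.1 x := rfl

lemma le_maxNorm (p : CStarSeminorms A B) (x : AlgTensor A B) : p.1 x ≤ maxNorm A B x := le_sup p x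

lemma maxNorm_isCStarSeminorm : IsCStarSeminorm (maxNorm A B) where
  mul_le x y := ciSup_le fun p => (p.2.mul_le x y).trans
    (mul_le_mul (le_sup p x) (le_sup p y) (apply_nonneg _ _) (sup_nonneg x))
  star_mul_self x := by
    apply le_antisymm
    · refine ciSup_le fun p => ?_
      rw [p.2.star_mul_self]
      exact pow_le_pow_left₀ (apply_nonneg _ _) (le_maxNorm p x) 2
    · have h0 : 0 ≤ maxNorm A B (star x * x) := apply_nonneg _ _
      rw [← Real.sqrt_le_sqrt_iff h0, Real.sqrt_sq (apply_nonneg _ _)]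
      refine ciSup_le fun p => Real.le_sqrt_of_sq_le ?_
      rw [← p.2.star_mul_self]
      exact le_maxNorm p _
  tmul_le a b := ciSup_le fun p => p.2.tmul_le a b

instance : SeminormedAddCommGroup (AlgTensor A B) :=
  (maxNorm A B).toAddGroupSeminorm.toSeminormedAddCommGroup

lemma norm_def (x : AlgTensor A B) : ‖x‖ = maxNorm A B x := rfl

instance : NormedSpace ℂ (AlgTensor A B) where
  norm_smul_le c x := (map_smul_eq_mul (maxNorm A B) c x).le

lemma norm_mul_le' (x y : AlgTensor A B) : ‖x * y‖ ≤ ‖x‖ * ‖y‖ :=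
  maxNorm_isCStarSeminorm.mul_le x y

lemma norm_star' (x : AlgTensor A B) : ‖star x‖ = ‖x‖ := by
  refine le_antisymm ?_ (maxNorm_isCStarSeminorm.star_le x)
  have := maxNorm_isCStarSeminorm.star_le (star x)
  rwa [star_star] at this

/-- The pull-back of a C*-seminorm by `γ ⊗ γ`. -/
lemma IsCStarSeminorm.comp_γMap {p : Seminorm ℂ (AlgTensor A B)} (hp : IsCStarSeminorm p) :
    IsCStarSeminorm (p.comp (γMap A B)) where
  mul_le x y := by
    simp only [Seminorm.comp_apply, γMap_mul]; exact hp.mul_le _ _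
  star_mul_self x := by
    simp only [Seminorm.comp_apply, γMap_mul, γMap_star]; exact hp.star_mul_self _
  tmul_le a b := by
    rw [Seminorm.comp_apply, γMap_tmul]
    refine (hp.tmul_le _ _).trans ?_
    rw [norm_γ, norm_γ]

lemma norm_γMap (x : AlgTensor A B) : ‖γMap A B x‖ = ‖x‖ := by
  have h : ∀ y : AlgTensor A B, ‖γMap A B y‖ ≤ ‖y‖ := fun y =>
    ciSup_le fun p => le_maxNorm ⟨_, p.2.comp_γMap⟩ y
  refine le_antisymm (h x) ?_
  simpa only [γMap_γMap] using h (γMap A B x)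

end AlgTensor

open UniformSpace

/-- The maximal graded tensor product `A ⊗̂ B`: the completion of the algebraic graded tensor product
in the maximal C*-seminorm. -/
def GTensor (A B : Type*) [NonUnitalCStarAlgebra A] [Grading A] [NonUnitalCStarAlgebra B]
    [Grading B] : Type _ :=
  Completion (AlgTensor A B)

namespace GTensor

variable {A B : Type*} [NonUnitalCStarAlgebra A] [Grading A] [NonUnitalCStarAlgebra B] [Grading B]

instance : NormedAddCommGroup (GTensor A B) :=
  inferInstanceAs (NormedAddCommGroup (Completion (AlgTensor A B)))
instance : NormedSpace ℂ (GTensor A B) :=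
  inferInstanceAs (NormedSpace ℂ (Completion (AlgTensor A B)))
instance : CompleteSpace (GTensor A B) :=
  inferInstanceAs (CompleteSpace (Completion (AlgTensor A B)))

/-- The canonical map from the algebraic tensor product. -/
def of (x : AlgTensor A B) : GTensor A B := (x : Completion (AlgTensor A B))

/-- Elementary tensors `a ⊗̂ b`. -/
def tmul (a : A) (b : B) : GTensor A B := of (AlgTensor.tmul a b)

lemma of_add (x y : AlgTensor A B) : of (x + y) = of x + of y := Completion.coe_add x y
lemma of_smul (c : ℂ) (x : AlgTensor A B) : of (c • x) = c • of x := Completion.coe_smul c x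
lemma of_zero : of (0 : AlgTensor A B) = 0 := Completion.coe_zero
lemma norm_of (x : AlgTensor A B) : ‖of x‖ = ‖x‖ := Completion.norm_coe x
lemma denseRange_of : DenseRange (of : AlgTensor A B → GTensor A B) := Completion.denseRange_coe

lemma continuous_of : Continuous (of : AlgTensor A B → GTensor A B) :=
  Completion.continuous_coe (AlgTensor A B)
lemma di : IsDenseInducing (of : AlgTensor A B → GTensor A B) := Completion.isDenseInducing_coe

lemma ind {p : GTensor A B → Prop} (x : GTensor A B) (hc : IsClosed {x | p x})
    (h : ∀ x : AlgTensor A B, p (of x)) : p x := Completion.induction_on x hc h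

lemma continuous_algMul :
    Continuous fun p : AlgTensor A B × AlgTensor A B => p.1 * p.2 :=
  ((LinearMap.mul ℂ (AlgTensor A B)).mkContinuous₂ 1
    (fun x y => by rw [one_mul]; exact AlgTensor.norm_mul_le' x y)).continuous₂

instance : Mul (GTensor A B) :=
  ⟨fun x y => (di.prodMap di).extend (fun p : AlgTensor A B × AlgTensor A B => of (p.1 * p.2)) (x, y)⟩

lemma of_mul (x y : AlgTensor A B) : of (x * y) = of x * of y :=
  ((di.prodMap di).extend_eq (continuous_of.comp continuous_algMul) (x, y)).symm

instance : ContinuousMul (GTensor A B) where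
  continuous_mul := by
    let c : AlgTensor A B →+ GTensor A B := ⟨⟨of, of_zero⟩, of_add⟩
    let m := (AddMonoidHom.mul : AlgTensor A B →+ AlgTensor A B →+ AlgTensor A B).compr₂ c
    have hm : Continuous fun p : AlgTensor A B × AlgTensor A B => m p.1 p.2 :=
      continuous_of.comp continuous_algMul
    have hd : IsDenseInducing c := di
    exact hd.extend_Z_bilin hd hm

instance : Star (GTensor A B) :=
  ⟨Completion.map (star : AlgTensor A B → AlgTensor A B)⟩

lemma isometry_star : Isometry (star : AlgTensor A B → AlgTensor A B) :=
  AddMonoidHomClass.isometry_of_norm (starAddEquiv : AlgTensor A B ≃+ AlgTensor A B)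
    AlgTensor.norm_star'

lemma of_star (x : AlgTensor A B) : of (star x) = star (of x) :=
  (Completion.map_coe isometry_star.uniformContinuous x).symm

instance : ContinuousStar (GTensor A B) where
  continuous_star := Completion.continuous_map

lemma left_distrib' (a b c : GTensor A B) : a * (b + c) = a * b + a * c := by
  induction a using ind with
  | hc => exact isClosed_eq (by fun_prop) (by fun_prop)
  | h a =>
  induction b using ind with
  | hc => exact isClosed_eq (by fun_prop) (by fun_prop)
  | h b =>
  induction c using ind with
  | hc => exact isClosed_eq (by fun_prop) (by fun_prop)
  | h c => simp only [← of_add, ← of_mul, mul_add]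

lemma right_distrib' (a b c : GTensor A B) : (a + b) * c = a * c + b * c := by
  induction a using ind with
  | hc => exact isClosed_eq (by fun_prop) (by fun_prop)
  | h a =>
  induction b using ind with
  | hc => exact isClosed_eq (by fun_prop) (by fun_prop)
  | h b =>
  induction c using ind with
  | hc => exact isClosed_eq (by fun_prop) (by fun_prop)
  | h c => simp only [← of_add, ← of_mul, add_mul]

lemma zero_mul' (a : GTensor A B) : 0 * a = 0 := by
  induction a using ind with
  | hc => exact isClosed_eq (by fun_prop) (by fun_prop)
  | h a => simp only [← of_zero, ← of_mul, zero_mul]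

lemma mul_zero' (a : GTensor A B) : a * 0 = 0 := by
  induction a using ind with
  | hc => exact isClosed_eq (by fun_prop) (by fun_prop)
  | h a => simp only [← of_zero, ← of_mul, mul_zero]

lemma mul_assoc' (a b c : GTensor A B) : a * b * c = a * (b * c) := by
  induction a using ind with
  | hc => exact isClosed_eq ((continuous_mul_const b).mul continuous_const) (continuous_mul_const (b * c))
  | h a =>
  induction b using ind with
  | hc => exact isClosed_eq ((continuous_const_mul _).mul continuous_const) (continuous_const.mul (continuous_mul_const c))
  | h b =>
  induction c using ind with
  | hc => exact isClosed_eq (continuous_const_mul _) (continuous_const.mul (continuous_const_mul _))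
  | h c => simp only [← of_mul, mul_assoc]

lemma norm_mul_le' (a b : GTensor A B) : ‖a * b‖ ≤ ‖a‖ * ‖b‖ := by
  induction a using ind with
  | hc => exact isClosed_le (by fun_prop) (by fun_prop)
  | h a =>
  induction b using ind with
  | hc => exact isClosed_le (by fun_prop) (by fun_prop)
  | h b => simpa only [← of_mul, norm_of] using AlgTensor.norm_mul_le' a b

lemma star_involutive' (a : GTensor A B) : star (star a) = a := by
  induction a using ind with
  | hc => exact isClosed_eq (by fun_prop) (by fun_prop)
  | h a => rw [← of_star, ← of_star, star_star]

lemma star_mul' (a b : GTensor A B) : star (a * b) = star b * star a := by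
  induction a using ind with
  | hc => exact isClosed_eq (by fun_prop) (by fun_prop)
  | h a =>
  induction b using ind with
  | hc => exact isClosed_eq (by fun_prop) (by fun_prop)
  | h b => simp only [← of_star, ← of_mul, star_mul]

lemma star_add' (a b : GTensor A B) : star (a + b) = star a + star b := by
  induction a using ind with
  | hc => exact isClosed_eq (by fun_prop) (by fun_prop)
  | h a =>
  induction b using ind with
  | hc => exact isClosed_eq (by fun_prop) (by fun_prop)
  | h b => simp only [← of_star, ← of_add, star_add]

lemma norm_mul_self_le' (a : GTensor A B) : ‖a‖ * ‖a‖ ≤ ‖star a * a‖ := by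
  induction a using ind with
  | hc => exact isClosed_le (by fun_prop) (by fun_prop)
  | h a =>
    rw [← of_star, ← of_mul, norm_of, norm_of, ← sq]
    exact (AlgTensor.maxNorm_isCStarSeminorm.star_mul_self a).ge

lemma smul_assoc' (c : ℂ) (a b : GTensor A B) : (c • a) * b = c • (a * b) := by
  induction a using ind with
  | hc => exact isClosed_eq ((continuous_const_smul c).mul continuous_const) ((continuous_mul_const b).const_smul c)
  | h a =>
  induction b using ind with
  | hc => exact isClosed_eq (continuous_const_mul _) ((continuous_const_mul _).const_smul c)
  | h b => rw [← of_smul, ← of_mul, ← of_mul, smul_mul_assoc, of_smul]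

lemma smul_comm' (c : ℂ) (a b : GTensor A B) : c • (a * b) = a * (c • b) := by
  induction a using ind with
  | hc => exact isClosed_eq ((continuous_mul_const b).const_smul c) (continuous_mul_const _)
  | h a =>
  induction b using ind with
  | hc => exact isClosed_eq ((continuous_const_mul _).const_smul c) (continuous_const.mul (continuous_const_smul c))
  | h b => rw [← of_smul, ← of_mul, ← of_mul, mul_smul_comm, of_smul]

lemma star_smul' (c : ℂ) (a : GTensor A B) : star (c • a) = star c • star a := by
  induction a using ind with
  | hc => exact isClosed_eq (continuous_const_smul c).star ((continuous_const_smul (star c)).comp continuous_star)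
  | h a => rw [← of_smul, ← of_star, ← of_star, star_smul, of_smul]

instance : NonUnitalRing (GTensor A B) where
  left_distrib := left_distrib'
  right_distrib := right_distrib'
  zero_mul := zero_mul'
  mul_zero := mul_zero'
  mul_assoc := mul_assoc'

instance : StarRing (GTensor A B) where
  star_involutive := star_involutive'
  star_mul := star_mul'
  star_add := star_add'

instance : NonUnitalCStarAlgebra (GTensor A B) where
  __ : NonUnitalRing (GTensor A B) := inferInstance
  __ : NormedAddCommGroup (GTensor A B) := inferInstance
  __ : NormedSpace ℂ (GTensor A B) := inferInstance
  __ : StarRing (GTensor A B) := inferInstance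
  __ : CompleteSpace (GTensor A B) := inferInstance
  norm_mul_le := norm_mul_le'
  norm_mul_self_le := norm_mul_self_le'
  smul_assoc := smul_assoc'
  smul_comm := smul_comm'
  star_smul := star_smul'

/-- The extension of `γ ⊗ γ` to the completion. -/
def γExt : GTensor A B → GTensor A B := Completion.map (AlgTensor.γMap A B)

lemma γExt_of (x : AlgTensor A B) : γExt (of x) = of (AlgTensor.γMap A B x) :=
  Completion.map_coe (AddMonoidHomClass.isometry_of_norm (AlgTensor.γMap A B)
    AlgTensor.norm_γMap).uniformContinuous x

lemma continuous_γExt : Continuous (γExt : GTensor A B → GTensor A B) := Completion.continuous_map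

lemma γExt_γExt (x : GTensor A B) : γExt (γExt x) = x := by
  induction x using ind with
  | hc => exact isClosed_eq (continuous_γExt.comp continuous_γExt) continuous_id
  | h x => rw [γExt_of, γExt_of, AlgTensor.γMap_γMap]

/-- `A ⊗̂ B` is graded by `γ ⊗̂ γ`. -/
instance : Grading (GTensor A B) where
  γ :=
    { toFun := γExt
      invFun := γExt
      left_inv := γExt_γExt
      right_inv := γExt_γExt
      map_mul' := fun a b => by
        have := continuous_γExt (A := A) (B := B)
        induction a using ind with
        | hc => exact isClosed_eq (by fun_prop) (by fun_prop)
        | h a =>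
        induction b using ind with
        | hc => exact isClosed_eq (by fun_prop) (by fun_prop)
        | h b => rw [← of_mul, γExt_of, γExt_of, γExt_of, AlgTensor.γMap_mul, of_mul]
      map_add' := fun a b => by
        have := continuous_γExt (A := A) (B := B)
        induction a using ind with
        | hc => exact isClosed_eq (by fun_prop) (by fun_prop)
        | h a =>
        induction b using ind with
        | hc => exact isClosed_eq (by fun_prop) (by fun_prop)
        | h b => rw [← of_add, γExt_of, γExt_of, γExt_of, map_add, of_add]
      map_star' := fun a => by
        have := continuous_γExt (A := A) (B := B)
        induction a using ind with
        | hc => exact isClosed_eq (by fun_prop) (by fun_prop)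
        | h a => rw [← of_star, γExt_of, γExt_of, AlgTensor.γMap_star, of_star]
      map_smul' := fun c a => by
        have := continuous_γExt (A := A) (B := B)
        induction a using ind with
        | hc => exact isClosed_eq (this.comp (continuous_const_smul c)) (this.const_smul c)
        | h a => rw [← of_smul, γExt_of, γExt_of, map_smul, of_smul] }
  γ_γ := γExt_γExt

end GTensor

/-! ### Unbounded self-adjoint multipliers -/

/-- An unbounded self-adjoint multiplier of `B`: a regular self-adjoint operator on `B`, viewed as a
right Hilbert module over itself with inner product `⟨x, y⟩ = x* y`. -/
structure UMultiplier (B : Type*) [NonUnitalCStarAlgebra B] where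
  /-- The underlying operator. -/
  op : B →ₗ.[ℂ] B
  dense : Dense (op.domain : Set B)
  /-- The domain is a right `B`-submodule and the operator is right `B`-linear. -/
  right_linear : ∀ (x : op.domain) (b : B), ∃ h : (x : B) * b ∈ op.domain, op ⟨x * b, h⟩ = op x * b
  isClosed : op.IsClosed
  symmetric : ∀ x z : op.domain, star (op z) * (x : B) = star (z : B) * op x
  /-- The domain of the adjoint is contained in the domain. -/
  adjoint_le : ∀ x : B, (∃ y : B, ∀ z : op.domain, star (op z) * x = star (z : B) * y) →
    x ∈ op.domain
  /-- Regularity: `1 + D²` has dense range. -/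
  regular : Dense {y : B | ∃ (x : op.domain) (h : op x ∈ op.domain), y = (x : B) + op ⟨op x, h⟩}

namespace UMultiplier

variable {B : Type*} [NonUnitalCStarAlgebra B]

/-- The zero multiplier, defined everywhere. -/
instance : Zero (UMultiplier B) where
  zero :=
    { op := 0
      dense := by simp
      right_linear := fun x b => ⟨trivial, by simp [LinearPMap.zero_apply]⟩
      isClosed := by
        have : ((0 : B →ₗ.[ℂ] B).graph : Set (B × B)) = {p | p.2 = 0} := by
          ext ⟨x, y⟩
          simp only [SetLike.mem_coe, LinearPMap.mem_graph_iff, Set.mem_ofPred_eq]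
          constructor
          · rintro ⟨z, -, rfl⟩; exact LinearPMap.zero_apply z
          · rintro rfl; exact ⟨⟨x, trivial⟩, rfl, LinearPMap.zero_apply _⟩
        rw [LinearPMap.IsClosed, this]
        exact isClosed_eq continuous_snd continuous_const
      symmetric := fun x z => by simp [LinearPMap.zero_apply]
      adjoint_le := fun x _ => trivial
      regular := by
        convert dense_univ
        refine Set.eq_univ_of_forall fun y => ⟨⟨y, trivial⟩, trivial, ?_⟩
        simp [LinearPMap.zero_apply] }

variable (D : UMultiplier B)

/-- `D + c`, for a scalar `c`, as a linear map on the domain of `D`. -/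
def shift (c : ℂ) : D.op.domain →ₗ[ℂ] B := D.op.toFun + c • D.op.domain.subtype

lemma shift_apply (c : ℂ) (x : D.op.domain) : D.shift c x = D.op x + c • (x : B) := rfl

lemma norm_le_shift {c : ℂ} (hc : star c = -c) (hc' : star c * c = 1) (x : D.op.domain) :
    ‖(x : B)‖ ≤ ‖D.shift c x‖ := by
  let _ := CStarAlgebra.spectralOrder B
  let _ := CStarAlgebra.spectralOrderedRing B
  have key : star (D.shift c x) * D.shift c x = star (D.op x) * D.op x + star (x : B) * x := by
    have hs := D.symmetric x x
    rw [shift_apply, star_add, star_smul, add_mul, mul_add, mul_add, smul_mul_smul_comm, hc', one_smul,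
      mul_smul_comm, smul_mul_assoc, hs, hc]
    module
  have hle : star (x : B) * x ≤ star (D.shift c x) * D.shift c x := by
    rw [key]; exact le_add_of_nonneg_left (star_mul_self_nonneg _)
  have := CStarAlgebra.norm_le_norm_of_nonneg_of_le (star_mul_self_nonneg (x : B)) hle
  rw [CStarRing.norm_star_mul_self, CStarRing.norm_star_mul_self] at this
  exact (mul_self_le_mul_self_iff (norm_nonneg _) (norm_nonneg _)).2 this

lemma shift_injective {c : ℂ} (hc : star c = -c) (hc' : star c * c = 1) :
    Function.Injective (D.shift c) := by
  rw [injective_iff_map_eq_zero]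
  intro x hx
  have := D.norm_le_shift hc hc' x
  rw [hx, norm_zero] at this
  exact Subtype.ext (norm_le_zero_iff.1 this)

lemma isClosed_range_shift {c : ℂ} (hc : star c = -c) (hc' : star c * c = 1) :
    IsClosed (Set.range (D.shift c)) := by
  refine isClosed_of_closure_subset fun y hy => ?_
  obtain ⟨u, hu, hlim⟩ := mem_closure_iff_seq_limit.1 hy
  choose x hx using hu
  have hC : CauchySeq fun n => (x n : B) := by
    have hCu := hlim.cauchySeq
    rw [Metric.cauchySeq_iff] at hCu ⊢
    intro ε hε
    obtain ⟨N, hN⟩ := hCu ε hε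
    refine ⟨N, fun m hm n hn => lt_of_le_of_lt ?_ (hN m hm n hn)⟩
    rw [dist_eq_norm, dist_eq_norm, ← hx m, ← hx n, ← map_sub]
    exact D.norm_le_shift hc hc' (x m - x n)
  obtain ⟨x₀, hx₀⟩ := cauchySeq_tendsto_of_complete hC
  have hD : Tendsto (fun n => D.op (x n)) atTop (𝓝 (y - c • x₀)) := by
    have h1 := hlim.sub (hx₀.const_smul c)
    refine h1.congr fun n => ?_
    rw [← hx n, shift_apply, add_sub_cancel_right]
  have hmem : (x₀, y - c • x₀) ∈ (D.op.graph : Set (B × B)) :=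
    D.isClosed.mem_of_tendsto (hx₀.prodMk_nhds hD)
      (Eventually.of_forall fun n => D.op.mem_graph (x n))
  obtain ⟨z, hz, hz'⟩ := (LinearPMap.mem_graph_iff _).1 hmem
  exact ⟨z, by rw [shift_apply, hz', hz]; exact sub_add_cancel _ _⟩

lemma shift_surjective {c : ℂ} (hc : star c = -c) (hc' : star c * c = 1) :
    Function.Surjective (D.shift c) := by
  rw [← Set.range_eq_univ, ← (D.isClosed_range_shift hc hc').closure_eq, ← dense_iff_closure_eq]
  refine D.regular.mono ?_
  rintro _ ⟨x, h, rfl⟩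
  refine ⟨⟨D.op x, h⟩ - c • x, ?_⟩
  have hcc : c * c = -1 := by rw [hc, neg_mul, neg_eq_iff_eq_neg] at hc'; exact hc'
  rw [map_sub, map_smul, shift_apply, shift_apply, smul_add, smul_smul, hcc]
  module

/-- `(D + c)⁻¹` as a linear map. -/
def resolventL {c : ℂ} (hc : star c = -c) (hc' : star c * c = 1) : B →ₗ[ℂ] B :=
  D.op.domain.subtype.comp
    ((LinearEquiv.ofBijective (D.shift c)
      ⟨D.shift_injective hc hc', D.shift_surjective hc hc'⟩).symm : B →ₗ[ℂ] D.op.domain)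

lemma resolventL_shift {c : ℂ} (hc : star c = -c) (hc' : star c * c = 1) (x : D.op.domain) :
    D.resolventL hc hc' (D.shift c x) = x := by
  have := (LinearEquiv.ofBijective (D.shift c)
      ⟨D.shift_injective hc hc', D.shift_surjective hc hc'⟩).symm_apply_apply x
  exact congrArg Subtype.val this

lemma norm_resolventL_le {c : ℂ} (hc : star c = -c) (hc' : star c * c = 1) (b : B) :
    ‖D.resolventL hc hc' b‖ ≤ 1 * ‖b‖ := by
  obtain ⟨x, rfl⟩ := D.shift_surjective hc hc' b
  rw [resolventL_shift, one_mul]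
  exact D.norm_le_shift hc hc' x

lemma star_I : star Complex.I = -Complex.I := Complex.conj_I
lemma star_I_mul : star Complex.I * Complex.I = 1 := by rw [star_I, neg_mul, Complex.I_mul_I, neg_neg]
lemma star_neg_I : star (-Complex.I) = - -Complex.I := by rw [star_neg, star_I]
lemma star_neg_I_mul : star (-Complex.I) * (-Complex.I) = 1 := by
  rw [star_neg, neg_mul_neg, star_I_mul]

/-- `(D + i)⁻¹` as a bounded operator on `B`. -/
def resPlus : B →L[ℂ] B := (D.resolventL star_I star_I_mul).mkContinuous 1
  (D.norm_resolventL_le _ _)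

/-- `(D - i)⁻¹` as a bounded operator on `B`. -/
def resMinus : B →L[ℂ] B := (D.resolventL star_neg_I star_neg_I_mul).mkContinuous 1
  (D.norm_resolventL_le _ _)

lemma resPlus_shift (x : D.op.domain) : D.resPlus (D.op x + Complex.I • (x : B)) = x :=
  D.resolventL_shift star_I star_I_mul x

lemma resMinus_shift (x : D.op.domain) : D.resMinus (D.op x + (-Complex.I) • (x : B)) = x :=
  D.resolventL_shift star_neg_I star_neg_I_mul x

lemma star_resMinus_mul (x y : B) : star (D.resMinus x) * y = star x * D.resPlus y := by
  obtain ⟨x, rfl⟩ := D.shift_surjective star_neg_I star_neg_I_mul x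
  obtain ⟨y, rfl⟩ := D.shift_surjective star_I star_I_mul y
  rw [shift_apply, shift_apply, resPlus_shift, resMinus_shift, mul_add, star_add, add_mul, star_smul,
    star_neg_I, neg_neg, D.symmetric, mul_smul_comm, smul_mul_assoc]

/-- The resolvent `(D + i)⁻¹` as an element of `M(B)`. Its right action is determined by its left
action and the adjoint `(D - i)⁻¹`. -/
def resolvent : 𝓜(ℂ, B) where
  fst := D.resPlus
  snd := (((starₗᵢ ℂ : B ≃ₗᵢ⋆[ℂ] B) : B →L⋆[ℂ] B).comp D.resMinus).comp
    ((starₗᵢ ℂ : B ≃ₗᵢ⋆[ℂ] B) : B →L⋆[ℂ] B)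
  central := fun x y => by
    have := D.star_resMinus_mul (star x) y
    rwa [star_star] at this

lemma multiplier_ext {T U : 𝓜(ℂ, B)} (h : ∀ b, T.fst b = U.fst b) : T = U := by
  rw [← sub_eq_zero, ← norm_eq_zero, ← DoubleCentralizer.norm_fst, norm_eq_zero]
  ext b
  simp [h b]

lemma resolvent_fst (b : B) : D.resolvent.fst b = D.resPlus b := rfl

lemma star_resolvent_fst (b : B) : (star D.resolvent).fst b = D.resMinus b := by
  rw [DoubleCentralizer.star_fst]
  change star (star (D.resMinus (star (star b)))) = _
  rw [star_star, star_star]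

lemma star_resolvent_sub : star D.resolvent - D.resolvent =
    (2 * Complex.I) • (D.resolvent * star D.resolvent) := by
  refine multiplier_ext fun b => ?_
  obtain ⟨x, rfl⟩ := D.shift_surjective star_neg_I star_neg_I_mul b
  have h1 := D.resMinus_shift x
  have h2 : D.resPlus (D.shift (-Complex.I) x) =
      (x : B) - (2 * Complex.I) • D.resPlus x := by
    have := D.resPlus_shift x
    rw [← map_smul, eq_sub_iff_add_eq, ← map_add, ← this]
    congr 1
    rw [shift_apply, this]
    module
  change (star D.resolvent).fst _ - D.resolvent.fst _ =
    (2 * Complex.I) • D.resolvent.fst ((star D.resolvent).fst _)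
  rw [star_resolvent_fst, resolvent_fst, resolvent_fst, h2]
  rw [shift_apply, h1, sub_sub_cancel]

lemma star_resolvent_sub' : star D.resolvent - D.resolvent =
    (2 * Complex.I) • (star D.resolvent * D.resolvent) := by
  refine multiplier_ext fun b => ?_
  obtain ⟨x, rfl⟩ := D.shift_surjective star_I star_I_mul b
  have h1 := D.resPlus_shift x
  have h2 : D.resMinus (D.shift Complex.I x) =
      (x : B) + (2 * Complex.I) • D.resMinus x := by
    have := D.resMinus_shift x
    rw [← map_smul, ← sub_eq_iff_eq_add, ← map_sub, ← this]
    congr 1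
    rw [shift_apply, this]
    module
  change (star D.resolvent).fst _ - D.resolvent.fst _ =
    (2 * Complex.I) • (star D.resolvent).fst (D.resolvent.fst _)
  rw [star_resolvent_fst, resolvent_fst, star_resolvent_fst, h2]
  rw [shift_apply, h1, add_sub_cancel_left]

instance isStarNormal_resolvent : IsStarNormal D.resolvent where
  star_comm_self := by
    have h := D.star_resolvent_sub'.symm.trans D.star_resolvent_sub
    exact smul_right_injective _ (by simp : (2 * Complex.I) ≠ 0) h

/-- Nonzero points of the spectrum of `(D + i)⁻¹` are of the form `(x + i)⁻¹` with `x` real. -/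
lemma im_inv_of_mem_spectrum {z : ℂ} (hz : z ∈ spectrum ℂ D.resolvent) (h0 : z ≠ 0) :
    (z⁻¹).im = 1 := by
  have h : cfc (fun w : ℂ => star w - w - (2 * Complex.I) * (w * star w)) D.resolvent = 0 := by
    rw [cfc_sub _ _ D.resolvent, cfc_sub _ _ D.resolvent, cfc_const_mul _ _ D.resolvent,
      cfc_mul _ _ D.resolvent, cfc_star, cfc_id' ℂ D.resolvent, ← star_resolvent_sub, sub_self]
  have hz' : star z - z - (2 * Complex.I) * (z * star z) = 0 := by
    have hm := cfc_map_spectrum (R := ℂ)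
      (fun w : ℂ => star w - w - (2 * Complex.I) * (w * star w)) D.resolvent
    rw [h] at hm
    have hmem : star z - z - (2 * Complex.I) * (z * star z) ∈ spectrum ℂ (0 : 𝓜(ℂ, B)) := by
      rw [hm]; exact ⟨z, hz, rfl⟩
    have : Nontrivial 𝓜(ℂ, B) := by
      by_contra hn
      rw [not_nontrivial_iff_subsingleton] at hn
      rw [spectrum.of_subsingleton] at hmem
      exact hmem
    rwa [spectrum.zero_eq, Set.mem_singleton_iff] at hmem
  have hI : (z⁻¹).im = -z.im / Complex.normSq z := Complex.inv_im z
  have hn : Complex.normSq z ≠ 0 := by simpa using h0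
  have him := congrArg Complex.im hz'
  rw [Complex.star_def, Complex.mul_conj] at him
  simp at him
  rw [hI, div_eq_iff hn]
  linarith

/-- The functional calculus `f ↦ f(D) ∈ M(B)`, for `f ∈ C₀(ℝ)`, i.e. the `*`-homomorphism which
sends `x ↦ (x ± i)⁻¹` to `(D ± i)⁻¹`. It is obtained from the continuous functional calculus of the
normal element `R = (D + i)⁻¹`, whose spectrum lies in the closure of `{(x + i)⁻¹ | x ∈ ℝ}`: here
`z = (x + i)⁻¹` corresponds to `x = Re (z⁻¹)` and `z = 0` to `x = ∞`. -/
def fc (f : ℝ → ℂ) : 𝓜(ℂ, B) :=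
  cfc (fun z : ℂ => if z = 0 then 0 else f (z⁻¹).re) D.resolvent

/-- The functional calculus sends `x ↦ (x + i)⁻¹` to `(D + i)⁻¹`. -/
lemma fc_resolvent : D.fc (fun x => ((x : ℂ) + Complex.I)⁻¹) = D.resolvent := by
  rw [fc]
  conv_rhs => rw [← cfc_id' ℂ D.resolvent]
  refine cfc_congr fun z hz => ?_
  by_cases h0 : z = 0
  · simp [h0]
  · have h1 := D.im_inv_of_mem_spectrum hz h0
    simp only [h0, if_false]
    rw [inv_eq_iff_eq_inv]
    apply Complex.ext <;> simp [h1]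

/-- `D` is odd: `γ D γ = -D` (in particular the domain is graded). -/
def IsOdd [Grading B] : Prop :=
  ∀ x : D.op.domain, ∃ h : Grading.γ (x : B) ∈ D.op.domain,
    D.op ⟨Grading.γ (x : B), h⟩ = -Grading.γ (D.op x)

end UMultiplier

/-! ### Asymptotic morphisms and E-theory -/

/-- The parameter space `[1, ∞)`. -/
abbrev Ray : Type := Set.Ici (1 : ℝ)

/-- Asymptotic morphisms `A → B` between graded C*-algebras. -/
structure AsymptoticMorphism (A B : Type*) [NonUnitalCStarAlgebra A] [Grading A]
    [NonUnitalCStarAlgebra B] [Grading B] where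
  /-- The family of maps. -/
  toFun : Ray → A → B
  continuous : ∀ a, Continuous fun t => toFun t a
  add_smul : ∀ (a b : A) (c : ℂ),
    Tendsto (fun t => toFun t (a + c • b) - toFun t a - c • toFun t b) atTop (𝓝 0)
  mul : ∀ a b, Tendsto (fun t => toFun t (a * b) - toFun t a * toFun t b) atTop (𝓝 0)
  star : ∀ a, Tendsto (fun t => toFun t (star a) - star (toFun t a)) atTop (𝓝 0)
  graded : ∀ a, Tendsto (fun t => toFun t (Grading.γ a) - Grading.γ (toFun t a)) atTop (𝓝 0)

namespace AsymptoticMorphism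

variable {A B C : Type*} [NonUnitalCStarAlgebra A] [Grading A] [NonUnitalCStarAlgebra B] [Grading B]
  [NonUnitalCStarAlgebra C] [Grading C]

/-- Composition of an asymptotic morphism with a graded `*`-isomorphism. -/
def map (θ : B ≃⋆ₐ[ℂ] C) (hθ : IsGraded θ) (Φ : AsymptoticMorphism A B) :
    AsymptoticMorphism A C :=
  have hc : Continuous θ := AddMonoidHomClass.continuous_of_bound θ 1 fun a => by
    rw [one_mul]; exact NonUnitalStarAlgHom.norm_apply_le θ a
  have h0 : Tendsto θ (𝓝 0) (𝓝 0) := by simpa using hc.tendsto 0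
  { toFun := fun t a => θ (Φ.toFun t a)
    continuous := fun a => hc.comp (Φ.continuous a)
    add_smul := fun a b c => by simpa [Function.comp_def] using h0.comp (Φ.add_smul a b c)
    mul := fun a b => by simpa [Function.comp_def] using h0.comp (Φ.mul a b)
    star := fun a => by simpa [Function.comp_def, map_star] using h0.comp (Φ.star a)
    graded := fun a => by simpa [Function.comp_def, hθ _] using h0.comp (Φ.graded a) }

/-- Homotopy of asymptotic morphisms: there is an asymptotic morphism `A → C([0,1], B)` whose
evaluations at `0` and `1` are the two given ones. -/
def Homotopic (Φ Ψ : AsymptoticMorphism A B) : Prop :=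
  ∃ H : AsymptoticMorphism A C(unitInterval, B),
    ∀ t a, H.toFun t a 0 = Φ.toFun t a ∧ H.toFun t a 1 = Ψ.toFun t a

end AsymptoticMorphism

/-- The set `[[A, B]]` of homotopy classes of asymptotic morphisms. -/
def HomotopyClasses (A B : Type*) [NonUnitalCStarAlgebra A] [Grading A]
    [NonUnitalCStarAlgebra B] [Grading B] : Type _ :=
  Quot (AsymptoticMorphism.Homotopic (A := A) (B := B))

/-- `E(A, B) = [[S ⊗̂ A, B ⊗̂ 𝒦]]`. -/
abbrev ETheory (A B : Type*) [NonUnitalCStarAlgebra A] [Grading A]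
    [NonUnitalCStarAlgebra B] [Grading B] : Type _ :=
  HomotopyClasses (GTensor S A) (GTensor B K)

/-! ### Asymptotic pairs -/

section pairs

variable {A B : Type*} [NonUnitalCStarAlgebra A] [Grading A] [NonUnitalCStarAlgebra B] [Grading B]

/-- A `*`-homomorphism `A → M(B)` is strict if it maps an approximate unit of `A` to a strictly Cauchy
net in `M(B)`. -/
def IsStrict (φ : A →⋆ₙₐ[ℂ] 𝓜(ℂ, B)) : Prop :=
  ∃ l : Filter A, l.IsApproximateUnit ∧ (∀ᶠ e in l, ‖e‖ ≤ 1) ∧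
    ∀ b : B, Cauchy (l.map fun e => (φ e).fst b) ∧ Cauchy (l.map fun e => (φ e).snd b)

/-- `(φ, D)` is an asymptotic pair: `φ : A → M(B)` is a strict graded `*`-homomorphism, `D` is an odd
unbounded self-adjoint multiplier of `B`, and, for all `f ∈ S` and `a ∈ A`, `f(D) φ(a) ∈ B` and
`[f(t⁻¹ D), φ(a)] → 0` (graded commutator). -/
structure IsAsymptoticPair (φ : A →⋆ₙₐ[ℂ] 𝓜(ℂ, B)) (D : UMultiplier B) : Prop where
  graded : IsGraded φ
  strict : IsStrict φ
  odd : D.IsOdd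
  mem : ∀ (f : S) (a : A), ∃ b : B, D.fc f * φ a = DoubleCentralizer.coe ℂ b
  commutator : ∀ (f : S) (a : A),
    Tendsto (fun t : Ray => gradedCommutator (D.fc fun x => f ((t : ℝ)⁻¹ * x)) (φ a)) atTop (𝓝 0)

/-- `Φ : S ⊗̂ A → B` represents the asymptotic morphism `f ⊗̂ a ↦ f(t⁻¹ D) φ(a)`, which is only defined
up to asymptotic equivalence. -/
def Represents (φ : A →⋆ₙₐ[ℂ] 𝓜(ℂ, B)) (D : UMultiplier B)
    (Φ : AsymptoticMorphism (GTensor S A) B) : Prop :=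
  ∀ (f : S) (a : A),
    Tendsto (fun t : Ray => DoubleCentralizer.coe ℂ (Φ.toFun t (GTensor.tmul f a)) -
      (D.fc fun x => f ((t : ℝ)⁻¹ * x)) * φ a) atTop (𝓝 0)

variable (θ : B ≃⋆ₐ[ℂ] GTensor B K) (hθ : IsGraded θ)

/-- For stable `B`, with stabilization isomorphism `θ : B ≅ B ⊗̂ 𝒦`: the element `x ∈ E(A, B)` is a
class of `(φ, D)`. -/
def IsClassOf (φ : A →⋆ₙₐ[ℂ] 𝓜(ℂ, B)) (D : UMultiplier B) (x : ETheory A B) : Prop :=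
  ∃ Φ : AsymptoticMorphism (GTensor S A) B, Represents φ D Φ ∧ x = Quot.mk _ (Φ.map θ hθ)

variable (A) in
/-- `E'(A, B) ⊆ E(A, B)`: the set of classes of asymptotic pairs. -/
def EPrime : Set (ETheory A B) :=
  {x | ∃ (φ : A →⋆ₙₐ[ℂ] 𝓜(ℂ, B)) (D : UMultiplier B), IsAsymptoticPair φ D ∧ IsClassOf θ hθ φ D x}

end pairs

end ETh

end

open ETh

noncomputable section

namespace ETh

open BoundedContinuousFunction

/-! The homotopy is the obvious one, `(φ, s D)` for `0 ≤ s ≤ 1`, that is `f ⊗ a ↦ (s ↦ f(t⁻¹ s D)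
φ(a))` with values in `C([0,1], B)`. Two points make it work.

The functions must be norm continuous in `s`, also at `s = 0`, where `f(0 D)` means `f(0)`. In
general `r ↦ f(r D)` is only strongly continuous (`continuous_scaledFc_fst`), but since `φ(a)` lies
in `B` itself, this is exactly norm continuity of `f(r D) φ(a)`.

The commutators `[f(t⁻¹ s D), φ(a)]` must vanish uniformly in `s` (`eventually_commutator_le`). This
holds because `t⁻¹ s = (t / s)⁻¹` with `t / s ≥ t`; at `s = 0` the commutator is that of a scalar
and vanishes.

The family so obtained is an asymptotic `*`-homomorphism on the algebraic tensor product only. To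
extend it to `S ⊗̂ A` (`exists_asymptoticMorphism`), note that the limit superior of the norms is a
C*-seminorm, hence dominated by the maximal one. The closed graph of the family in `(S ⊗̂ A) × C_b`
is then a `*`-algebra which projects onto `S ⊗̂ A` and whose fibre over `0` consists of functions
vanishing at infinity, so any set-theoretic section of it is an asymptotic morphism.

For the classes to be well defined, asymptotic morphisms which agree asymptotically on elementary
tensors must be homotopic. Passing from a dense subset to the whole algebra requires an asymptotic
norm bound (`eventually_norm_le`), which is not part of the definition and is derived from the
`*`-algebraic relations. Asymptotically equivalent morphisms are then joined by a straight line. -/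

/-! ### The asymptotic seminorm of a bounded function on the ray -/

section asympNorm

variable {C : Type*} [NonUnitalCStarAlgebra C]

/-- The limit superior of `t ↦ ‖g t‖` as `t → ∞`. -/
def asympNorm (g : Ray →ᵇ C) : ℝ := sInf {c : ℝ | 0 ≤ c ∧ ∀ᶠ t in atTop, ‖g t‖ ≤ c}

lemma asympNorm_le {g : Ray →ᵇ C} {c : ℝ} (hc : 0 ≤ c) (h : ∀ᶠ t in atTop, ‖g t‖ ≤ c) :
    asympNorm g ≤ c :=
  csInf_le (show BddBelow {c : ℝ | 0 ≤ c ∧ ∀ᶠ t in atTop, ‖g t‖ ≤ c} from ⟨0, fun _ h => h.1⟩) ⟨hc, h⟩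

lemma asympNorm_le_norm (g : Ray →ᵇ C) : asympNorm g ≤ ‖g‖ :=
  asympNorm_le (norm_nonneg g) (Eventually.of_forall g.norm_coe_le_norm)

lemma eventually_norm_le {g : Ray →ᵇ C} {c : ℝ} (h : asympNorm g < c) :
    ∀ᶠ t in atTop, ‖g t‖ ≤ c := by
  have hne : {c : ℝ | 0 ≤ c ∧ ∀ᶠ t in atTop, ‖g t‖ ≤ c}.Nonempty :=
    ⟨‖g‖, norm_nonneg _, Eventually.of_forall g.norm_coe_le_norm⟩
  obtain ⟨d, ⟨-, hd⟩, hdc⟩ := exists_lt_of_csInf_lt hne h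
  filter_upwards [hd] with t ht using ht.trans hdc.le

lemma asympNorm_nonneg (g : Ray →ᵇ C) : 0 ≤ asympNorm g :=
  Real.sInf_nonneg fun _ h => h.1

lemma asympNorm_add_le (g h : Ray →ᵇ C) : asympNorm (g + h) ≤ asympNorm g + asympNorm h := by
  refine le_of_forall_pos_le_add fun ε hε => ?_
  have h1 := eventually_norm_le (lt_add_of_pos_right (asympNorm g) (half_pos hε))
  have h2 := eventually_norm_le (lt_add_of_pos_right (asympNorm h) (half_pos hε))
  refine asympNorm_le (by linarith [asympNorm_nonneg g, asympNorm_nonneg h]) ?_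
  filter_upwards [h1, h2] with t h1 h2
  exact (norm_add_le _ _).trans (by linarith)

lemma asympNorm_mul_le (g h : Ray →ᵇ C) : asympNorm (g * h) ≤ asympNorm g * asympNorm h := by
  -- The seminorm is an infimum that need not be an eventual bound, so the estimate is made with `ε`
  -- to spare and `ε` is sent to `0`.
  have hlim : Tendsto (fun ε : ℝ => (asympNorm g + ε) * (asympNorm h + ε)) (𝓝[>] 0)
      (𝓝 (asympNorm g * asympNorm h)) := by
    have : Continuous fun ε : ℝ => (asympNorm g + ε) * (asympNorm h + ε) := by fun_prop
    simpa using (this.tendsto 0).mono_left nhdsWithin_le_nhds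
  refine ge_of_tendsto hlim (eventually_mem_nhdsWithin.mono fun ε (hε : 0 < ε) => ?_)
  have hg := asympNorm_nonneg g
  have hh := asympNorm_nonneg h
  refine asympNorm_le (by positivity) ?_
  filter_upwards [eventually_norm_le (lt_add_of_pos_right (asympNorm g) hε),
    eventually_norm_le (lt_add_of_pos_right (asympNorm h) hε)] with t h1 h2
  exact (norm_mul_le _ _).trans (by gcongr)

lemma asympNorm_smul_le (c : ℂ) (g : Ray →ᵇ C) : asympNorm (c • g) ≤ ‖c‖ * asympNorm g := by
  have hlim : Tendsto (fun ε : ℝ => ‖c‖ * (asympNorm g + ε)) (𝓝[>] 0)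
      (𝓝 (‖c‖ * asympNorm g)) := by
    have : Continuous fun ε : ℝ => ‖c‖ * (asympNorm g + ε) := by fun_prop
    simpa using (this.tendsto 0).mono_left nhdsWithin_le_nhds
  refine ge_of_tendsto hlim (eventually_mem_nhdsWithin.mono fun ε (hε : 0 < ε) => ?_)
  have hg := asympNorm_nonneg g
  refine asympNorm_le (by positivity) ?_
  filter_upwards [eventually_norm_le (lt_add_of_pos_right (asympNorm g) hε)] with t h1
  exact (norm_smul_le _ _).trans (mul_le_mul_of_nonneg_left h1 (norm_nonneg c))

/-- The pointwise C*-identity `‖g t‖² = ‖g(t)* g(t)‖` turns an eventual bound `d` for `star g * g`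
into the bound `√d` for `g`. -/
lemma sq_asympNorm_le (g : Ray →ᵇ C) : asympNorm g ^ 2 ≤ asympNorm (star g * g) := by
  refine le_of_forall_gt fun c hc => ?_
  obtain ⟨d, hd, hdc⟩ := exists_between hc
  have hd0 : 0 ≤ d := (asympNorm_nonneg _).trans hd.le
  refine lt_of_le_of_lt ?_ hdc
  rw [← Real.sq_sqrt hd0]
  refine pow_le_pow_left₀ (asympNorm_nonneg g) (asympNorm_le (Real.sqrt_nonneg d) ?_) 2
  filter_upwards [eventually_norm_le hd] with t ht
  refine Real.le_sqrt_of_sq_le ?_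
  rw [sq, ← CStarRing.norm_star_mul_self]
  exact ht

lemma asympNorm_eq_zero_iff {g : Ray →ᵇ C} : asympNorm g = 0 ↔ Tendsto g atTop (𝓝 0) := by
  constructor
  · intro h
    rw [Metric.tendsto_nhds]
    intro ε hε
    filter_upwards [eventually_norm_le (h.trans_lt (half_pos hε))] with t ht
    rw [dist_zero_right]
    linarith
  · intro h
    refine le_antisymm (le_of_forall_pos_le_add fun ε hε => ?_) (asympNorm_nonneg g)
    refine asympNorm_le (by linarith) ?_
    filter_upwards [(Metric.tendsto_nhds.1 h) ε hε] with t ht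
    rw [dist_zero_right] at ht
    linarith

/-- The seminorm only sees the class of a function modulo those vanishing at infinity. This is what
converts asymptotic identities into exact inequalities. -/
lemma asympNorm_le_of_tendsto {g h : Ray →ᵇ C} (hgh : Tendsto (g - h) atTop (𝓝 0)) :
    asympNorm g ≤ asympNorm h := by
  have h1 : asympNorm (g - h) = 0 := asympNorm_eq_zero_iff.2 hgh
  have := asympNorm_add_le (g - h) h
  rwa [sub_add_cancel, h1, zero_add] at this

/-- A bounded function is asymptotic to one whose norm is close to its asymptotic seminorm. -/
lemma exists_norm_le_of_asympNorm_lt {g : Ray →ᵇ C} {c : ℝ} (h : asympNorm g < c) :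
    ∃ g' : Ray →ᵇ C, ‖g'‖ ≤ c ∧ Tendsto (g' - g) atTop (𝓝 0) := by
  have hc : 0 ≤ c := (asympNorm_nonneg g).trans h.le
  obtain ⟨T, hT⟩ := eventually_atTop.1 (eventually_norm_le h)
  -- A cut-off which is `0` for `t ≤ T` and `1` for `t ≥ T + 1`. It removes the initial segment,
  -- where `‖g t‖` may exceed `c`, and leaves the tail unchanged.
  let χ : Ray → ℝ := fun t => max 0 (min 1 ((t : ℝ) - T))
  have hχ : Continuous χ := by fun_prop
  have hχ0 : ∀ t, 0 ≤ χ t := fun t => le_max_left _ _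
  have hχ1 : ∀ t, χ t ≤ 1 := fun t => max_le zero_le_one (min_le_left _ _)
  have hb : ∀ t, ‖χ t • g t‖ ≤ c := fun t => by
    rw [norm_smul, Real.norm_of_nonneg (hχ0 t)]
    by_cases ht : T ≤ t
    · exact (mul_le_of_le_one_left (norm_nonneg _) (hχ1 t)).trans (hT t ht)
    · have hz : χ t = 0 := by
        have : (t : ℝ) - T ≤ 0 := sub_nonpos.2 (le_of_lt (not_le.1 ht))
        exact max_eq_left ((min_le_right _ _).trans this)
      rw [hz, zero_mul]
      exact hc
  refine ⟨BoundedContinuousFunction.ofNormedAddCommGroup (fun t => χ t • g t)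
    (hχ.smul g.continuous) c hb, norm_ofNormedAddCommGroup_le _ hc hb, ?_⟩
  refine tendsto_const_nhds.congr' ?_
  have hT1 : (1 : ℝ) ≤ T + 1 := by linarith [T.2.out]
  filter_upwards [eventually_ge_atTop (⟨T + 1, hT1⟩ : Ray)] with t ht
  have ht' : (T : ℝ) + 1 ≤ t := ht
  have hone : χ t = 1 := by
    simp only [χ]
    rw [min_eq_left (by linarith), max_eq_right zero_le_one]
  simp [hone]

lemma tendsto_zero_mul {g : Ray →ᵇ C} (hg : Tendsto g atTop (𝓝 0)) (h : Ray →ᵇ C) :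
    Tendsto (g * h) atTop (𝓝 0) := by
  rw [← asympNorm_eq_zero_iff] at hg ⊢
  exact le_antisymm ((asympNorm_mul_le _ _).trans (by rw [hg, zero_mul])) (asympNorm_nonneg _)

lemma tendsto_mul_zero {g : Ray →ᵇ C} (hg : Tendsto g atTop (𝓝 0)) (h : Ray →ᵇ C) :
    Tendsto (h * g) atTop (𝓝 0) := by
  rw [← asympNorm_eq_zero_iff] at hg ⊢
  exact le_antisymm ((asympNorm_mul_le _ _).trans (by rw [hg, mul_zero])) (asympNorm_nonneg _)

end asympNorm

/-! ### Asymptotic morphisms out of a graded tensor product -/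

section universal

variable {A B C : Type*} [NonUnitalCStarAlgebra A] [Grading A] [NonUnitalCStarAlgebra B] [Grading B]
  [NonUnitalCStarAlgebra C]

/-- A linear family of bounded functions on `A ⊙̂ B` which is asymptotically a `*`-homomorphism. -/
structure IsAsympHom (F : AlgTensor A B →ₗ[ℂ] (Ray →ᵇ C)) : Prop where
  map_mul : ∀ x y, Tendsto (F (x * y) - F x * F y) atTop (𝓝 0)
  map_star : ∀ x, Tendsto (F (star x) - star (F x)) atTop (𝓝 0)
  norm_le : ∀ a b, ‖F (.tmul a b)‖ ≤ ‖a‖ * ‖b‖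

variable {F : AlgTensor A B →ₗ[ℂ] (Ray →ᵇ C)}

variable (F) in
/-- The asymptotic seminorm of a linear family of bounded functions. -/
def asympSeminorm : Seminorm ℂ (AlgTensor A B) :=
  Seminorm.ofSMulLE (fun x => asympNorm (F x))
    (by rw [map_zero, asympNorm_eq_zero_iff]; exact tendsto_const_nhds)
    (fun x y => by rw [map_add]; exact asympNorm_add_le _ _)
    (fun c x => by rw [map_smul]; exact asympNorm_smul_le _ _)

/-- Modulo functions vanishing at infinity `F` is a genuine `*`-homomorphism, and `asympNorm` is the
pull-back of the C*-norm on that quotient. -/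
lemma IsAsympHom.isCStarSeminorm (hF : IsAsympHom F) :
    AlgTensor.IsCStarSeminorm (asympSeminorm F) := by
  have hmul : ∀ x y, asympNorm (F (x * y)) ≤ asympNorm (F x) * asympNorm (F y) := fun x y =>
    (asympNorm_le_of_tendsto (hF.map_mul x y)).trans (asympNorm_mul_le _ _)
  have hstarF : ∀ x, Tendsto (star (F x) - F (star x)) atTop (𝓝 0) := fun x => by
    have := (hF.map_star x).neg
    rw [neg_zero] at this
    exact this.congr fun t => neg_sub _ _
  have hsq : ∀ x, asympNorm (F x) ^ 2 ≤ asympNorm (F (star x * x)) := fun x => by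
    refine (sq_asympNorm_le _).trans (asympNorm_le_of_tendsto ?_)
    have h1 : Tendsto ((star (F x) - F (star x)) * F x) atTop (𝓝 0) := by
      rw [← asympNorm_eq_zero_iff]
      refine le_antisymm ((asympNorm_mul_le _ _).trans ?_) (asympNorm_nonneg _)
      rw [asympNorm_eq_zero_iff.2 (hstarF x), zero_mul]
    have h2 := (h1.sub (hF.map_mul (star x) x))
    rw [sub_zero] at h2
    refine h2.congr fun t => ?_
    simp only [coe_sub, coe_mul, Pi.sub_apply, Pi.mul_apply]
    noncomm_ring
  have hstar : ∀ x, asympNorm (F (star x)) ≤ asympNorm (F x) := fun x => by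
    have h1 : asympNorm (F (star x)) ≤ asympNorm (star (F x)) := asympNorm_le_of_tendsto (hF.map_star x)
    refine h1.trans (le_of_forall_gt fun c hc => ?_)
    obtain ⟨d, hd, hdc⟩ := exists_between hc
    refine lt_of_le_of_lt (asympNorm_le ((asympNorm_nonneg _).trans hd.le) ?_) hdc
    filter_upwards [eventually_norm_le hd] with t ht
    rw [star_apply, norm_star]
    exact ht
  exact
  { mul_le := hmul
    star_mul_self := fun x => le_antisymm ((hmul _ _).trans (by
      rw [sq]; exact mul_le_mul_of_nonneg_right (hstar x) (asympNorm_nonneg _))) (hsq x)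
    tmul_le := fun a b => (asympNorm_le_norm _).trans (hF.norm_le a b) }

/-- Here the maximality of the tensor norm enters: it dominates every C*-seminorm, in particular the
asymptotic one. -/
lemma IsAsympHom.asympNorm_le (hF : IsAsympHom F) (x : AlgTensor A B) :
    asympNorm (F x) ≤ ‖x‖ :=
  AlgTensor.le_maxNorm ⟨_, hF.isCStarSeminorm⟩ x

/-- The `*`-algebra of pairs `(x, g)` with `g` asymptotic to `F x`. -/
def IsAsympHom.graph (hF : IsAsympHom F) :
    NonUnitalStarSubalgebra ℂ (GTensor A B × (Ray →ᵇ C)) where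
  carrier := {p | ∃ x, p.1 = GTensor.of x ∧ Tendsto (p.2 - F x) atTop (𝓝 0)}
  zero_mem' := ⟨0, GTensor.of_zero.symm, by rw [map_zero]; exact tendsto_const_nhds.congr fun t => by simp⟩
  add_mem' := by
    rintro p q ⟨x, hx, hp⟩ ⟨y, hy, hq⟩
    refine ⟨x + y, by rw [GTensor.of_add, Prod.fst_add, hx, hy], ?_⟩
    have := hp.add hq
    rw [add_zero] at this
    refine this.congr fun t => ?_
    rw [map_add]
    simp only [coe_sub, coe_add, Pi.sub_apply, Pi.add_apply, Prod.snd_add]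
    abel
  smul_mem' := by
    rintro c p ⟨x, hx, hp⟩
    refine ⟨c • x, by rw [GTensor.of_smul, Prod.smul_fst, hx], ?_⟩
    have := hp.const_smul c
    rw [smul_zero] at this
    refine this.congr fun t => ?_
    rw [map_smul]
    simp [smul_sub]
  mul_mem' := by
    rintro p q ⟨x, hx, hp⟩ ⟨y, hy, hq⟩
    refine ⟨x * y, by rw [GTensor.of_mul, Prod.fst_mul, hx, hy], ?_⟩
    have := ((tendsto_zero_mul hp q.2).add (tendsto_mul_zero hq (F x))).sub (hF.map_mul x y)
    rw [add_zero, sub_zero] at this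
    refine this.congr fun t => ?_
    simp only [coe_sub, coe_mul, Pi.sub_apply, Pi.mul_apply, Prod.snd_mul]
    noncomm_ring
  star_mem' := by
    rintro p ⟨x, hx, hp⟩
    refine ⟨star x, by rw [GTensor.of_star, Prod.fst_star, hx], ?_⟩
    have := hp.star.sub (hF.map_star x)
    rw [star_zero, sub_zero] at this
    refine this.congr fun t => ?_
    simp only [coe_sub, coe_star, Pi.sub_apply, Pi.star_apply, Prod.snd_star, star_sub]
    abel

/-- If `(0, g)` is in the closure of the graph then `g` vanishes at infinity. -/
lemma IsAsympHom.tendsto_of_mem (hF : IsAsympHom F) {g : Ray →ᵇ C}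
    (hg : ((0 : GTensor A B), g) ∈ hF.graph.topologicalClosure) : Tendsto g atTop (𝓝 0) := by
  rw [← asympNorm_eq_zero_iff]
  refine le_antisymm (le_of_forall_pos_le_add fun ε hε => ?_) (asympNorm_nonneg g)
  obtain ⟨p, ⟨x, hx, hp⟩, hd⟩ := Metric.mem_closure_iff.1 hg (ε / 2) (half_pos hε)
  rw [Prod.dist_eq, max_lt_iff, dist_zero_left, dist_eq_norm] at hd
  -- With `(of x, p.2)` within `ε / 2` of `(0, g)`, the seminorm of `g` is at most `‖g - p.2‖` plus
  -- that of `F x`, and the latter is at most `‖x‖ < ε / 2`.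
  have h1 := asympNorm_add_le (g - p.2) p.2
  rw [sub_add_cancel] at h1
  have h2 := asympNorm_le_norm (g - p.2)
  have h3 := asympNorm_le_of_tendsto hp
  have h4 := hF.asympNorm_le x
  rw [← GTensor.norm_of, ← hx] at h4
  have h5 := hd.1
  have h6 := hd.2
  simp only at h5 h6
  linarith

/-- Lifts with norm control are what allows one to pass from the dense subalgebra to the completion.
The factor `2` only provides the strict inequality needed to cut off `F x`. -/
lemma IsAsympHom.exists_mem_of (hF : IsAsympHom F) (x : AlgTensor A B) :
    ∃ g : Ray →ᵇ C, (GTensor.of x, g) ∈ hF.graph ∧ ‖g‖ ≤ 2 * ‖GTensor.of x‖ := by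
  have hx := hF.asympNorm_le x
  rw [GTensor.norm_of]
  -- If `‖x‖ = 0` there is no room for a strict inequality, but then `F x` itself vanishes at
  -- infinity and `0` is a lift.
  rcases (norm_nonneg x).eq_or_lt with h0 | h0
  · rw [← h0] at hx ⊢
    have h := asympNorm_eq_zero_iff.1 (le_antisymm hx (asympNorm_nonneg _))
    refine ⟨0, ⟨x, rfl, ?_⟩, by simp⟩
    have := h.neg
    rw [neg_zero] at this
    exact this.congr fun t => by simp
  · obtain ⟨g, hg, hgx⟩ := exists_norm_le_of_asympNorm_lt
      (hx.trans_lt (lt_mul_of_one_lt_left h0 one_lt_two))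
    exact ⟨g, ⟨x, rfl, hgx⟩, hg⟩

/-- The closure of the graph projects onto `A ⊗̂ B`. -/
lemma IsAsympHom.exists_mem (hF : IsAsympHom F) (X : GTensor A B) :
    ∃ g : Ray →ᵇ C, (X, g) ∈ hF.graph.topologicalClosure := by
  let R := hF.graph.topologicalClosure
  have hcl : IsClosed (R : Set (GTensor A B × (Ray →ᵇ C))) :=
    NonUnitalStarSubalgebra.isClosed_topologicalClosure _
  have : CompleteSpace R := hcl.completeSpace_coe
  let f : NormedAddGroupHom R (GTensor A B) :=
    AddMonoidHom.mkNormedAddGroupHom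
      ((AddMonoidHom.fst (GTensor A B) (Ray →ᵇ C)).comp (AddSubgroupClass.subtype R)) 1
      (fun r => by rw [one_mul]; exact norm_fst_le (r : GTensor A B × (Ray →ᵇ C)))
  let K : AddSubgroup (GTensor A B) :=
    AddMonoidHom.range ⟨⟨GTensor.of, GTensor.of_zero⟩, GTensor.of_add⟩
  -- Elements of the dense subgroup `K` lift to the complete space `R` with constant `2`. By
  -- successive approximation every element of the closure of `K` then lifts.
  have hs : f.SurjectiveOnWith K 2 := by
    rintro _ ⟨x, rfl⟩
    obtain ⟨g, hg, hgx⟩ := hF.exists_mem_of x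
    refine ⟨⟨_, NonUnitalStarSubalgebra.le_topologicalClosure _ hg⟩, rfl, ?_⟩
    refine max_le ?_ hgx
    change ‖GTensor.of x‖ ≤ 2 * ‖GTensor.of x‖
    linarith [norm_nonneg (GTensor.of x)]
  have hX : X ∈ K.topologicalClosure := GTensor.denseRange_of X
  obtain ⟨r, hr, -⟩ := controlled_closure_of_complete two_pos one_pos hs X hX
  refine ⟨r.1.2, ?_⟩
  rw [← hr]
  exact r.2

variable [Grading C]

/-- The grading on bounded functions on the ray. -/
def γBCF (g : Ray →ᵇ C) : Ray →ᵇ C := (γL C).compLeftContinuousBounded Ray g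

lemma γBCF_apply (g : Ray →ᵇ C) (t : Ray) : γBCF g t = Grading.γ (g t) := rfl

lemma continuous_γ : Continuous fun a : A => Grading.γ a := (γL A).continuous

/-- `F` intertwines the gradings exactly, so they preserve the graph, and by continuity its closure.
-/
lemma IsAsympHom.γ_mem (hF : IsAsympHom F)
    (hγ : ∀ x t, F (AlgTensor.γMap A B x) t = Grading.γ (F x t))
    {X : GTensor A B} {g : Ray →ᵇ C} (h : (X, g) ∈ hF.graph.topologicalClosure) :
    (Grading.γ X, γBCF g) ∈ hF.graph.topologicalClosure := by
  have hc : Continuous fun p : GTensor A B × (Ray →ᵇ C) => (Grading.γ p.1, γBCF p.2) :=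
    (continuous_γ.comp continuous_fst).prodMk
      (((γL C).compLeftContinuousBounded Ray).continuous.comp continuous_snd)
  refine map_mem_closure (f := fun p : GTensor A B × (Ray →ᵇ C) => (Grading.γ p.1, γBCF p.2)) hc h ?_
  rintro p ⟨x, hx, hp⟩
  refine ⟨AlgTensor.γMap A B x, ?_, ?_⟩
  · rw [← GTensor.γExt_of, ← hx]
    rfl
  · have := (continuous_γ.tendsto (0 : C)).comp hp
    rw [map_zero] at this
    refine this.congr fun t => ?_
    simp [hγ, γBCF_apply]

/-- A family on the algebraic tensor product which is asymptotically a `*`-homomorphism extends to an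
asymptotic morphism on the maximal tensor product. -/
theorem IsAsympHom.exists_asymptoticMorphism (hF : IsAsympHom F)
    (hγ : ∀ x t, F (AlgTensor.γMap A B x) t = Grading.γ (F x t)) :
    ∃ Φ : AsymptoticMorphism (GTensor A B) C,
      ∀ x, Tendsto (fun t => Φ.toFun t (GTensor.of x) - F x t) atTop (𝓝 0) := by
  choose g hg using hF.exists_mem
  -- Two elements of the closed graph over the same `X` differ by one over `0`, hence by a function
  -- vanishing at infinity. Since the closed graph is a graded `*`-algebra, this yields every axiom
  -- of an asymptotic morphism for the arbitrary section `g`.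
  have key : ∀ {X : GTensor A B} {h : Ray →ᵇ C}, (X, h) ∈ hF.graph.topologicalClosure →
      Tendsto (g X - h) atTop (𝓝 0) := fun {X h} hX => by
    refine hF.tendsto_of_mem ?_
    have := sub_mem (hg X) hX
    rwa [Prod.mk_sub_mk, sub_self] at this
  refine ⟨
    { toFun := fun t X => g X t
      continuous := fun X => (g X).continuous
      add_smul := fun X Y c => ?_
      mul := fun X Y => key (mul_mem (hg X) (hg Y))
      star := fun X => key (star_mem (hg X))
      graded := fun X => key (hF.γ_mem hγ (hg X)) }, fun x => ?_⟩
  · have := key (X := X + c • Y) (h := g X + c • g Y)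
      (add_mem (hg X) (SMulMemClass.smul_mem c (hg Y)))
    refine this.congr fun t => ?_
    simp [sub_sub]
  · refine key (NonUnitalStarSubalgebra.le_topologicalClosure _ ⟨x, rfl, ?_⟩)
    exact tendsto_const_nhds.congr fun t => by simp

end universal

/-! ### The functional calculus of an unbounded self-adjoint multiplier -/

namespace UMultiplier

variable {B : Type*} [NonUnitalCStarAlgebra B] (D : UMultiplier B)

/-- The function on `ℂ` which corresponds to `f` under `z = (x + i)⁻¹`. -/
def cayley (f : ℝ → ℂ) (z : ℂ) : ℂ := if z = 0 then 0 else f (z⁻¹).re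

lemma fc_eq (f : ℝ → ℂ) : D.fc f = cfc (cayley f) D.resolvent := rfl

/-- Only `z = 0`, which stands for `x = ∞`, needs an argument. On the spectrum `Im (z⁻¹) = 1`, so `z
→ 0` forces `|Re (z⁻¹)| → ∞`, where `f` vanishes. Off the spectrum the real part could stay bounded
and continuity at `0` could fail. -/
lemma continuousOn_cayley (f : S) : ContinuousOn (cayley f) (spectrum ℂ D.resolvent) := by
  intro z hz
  by_cases h0 : z = 0
  · subst h0
    have hz0 : cayley f 0 = 0 := if_pos rfl
    rw [ContinuousWithinAt, hz0, Metric.tendsto_nhds]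
    intro ε hε
    have hf : ∀ᶠ x in cocompact ℝ, ‖f x‖ < ε := by
      have := Metric.tendsto_nhds.1 (zero_at_infty f) ε hε
      simpa only [dist_zero_right] using this
    rw [← Metric.cobounded_eq_cocompact, ← comap_norm_atTop, eventually_comap] at hf
    obtain ⟨M, hM⟩ := eventually_atTop.1 hf
    -- For `‖w‖ < (|M| + 1)⁻¹` one has `‖w⁻¹‖ > |M| + 1`; the imaginary part accounts for `1`, which
    -- leaves `|Re (w⁻¹)| > |M|`.
    have hpos : 0 < (|M| + 1)⁻¹ := by positivity
    filter_upwards [self_mem_nhdsWithin, mem_nhdsWithin_of_mem_nhds (Metric.ball_mem_nhds 0 hpos)]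
      with w hw hwb
    rw [dist_zero_right]
    by_cases hw0 : w = 0
    · rw [hw0, hz0, norm_zero]
      exact hε
    · rw [cayley, if_neg hw0]
      refine hM _ ?_ _ rfl
      rw [mem_ball_zero_iff, lt_inv_comm₀ (norm_pos_iff.2 hw0) (by positivity), ← norm_inv] at hwb
      have h1 := Complex.norm_le_abs_re_add_abs_im w⁻¹
      rw [D.im_inv_of_mem_spectrum hw hw0, abs_one] at h1
      rw [Real.norm_eq_abs]
      linarith [le_abs_self M]
  · have h1 : cayley f =ᶠ[𝓝 z] fun w => f (w⁻¹).re := by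
      filter_upwards [isOpen_ne.mem_nhds h0] with w hw
      exact if_neg hw
    refine ContinuousAt.continuousWithinAt (ContinuousAt.congr ?_ h1.symm)
    exact f.continuous.continuousAt.comp
      (Complex.continuous_re.continuousAt.comp (continuousAt_inv₀ h0))

lemma cayley_add (f g : ℝ → ℂ) : cayley (f + g) = fun z => cayley f z + cayley g z := by
  ext z; by_cases h : z = 0 <;> simp [cayley, h]

lemma cayley_mul (f g : ℝ → ℂ) : cayley (f * g) = fun z => cayley f z * cayley g z := by
  ext z; by_cases h : z = 0 <;> simp [cayley, h]

lemma cayley_smul (c : ℂ) (f : ℝ → ℂ) : cayley (c • f) = fun z => c * cayley f z := by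
  ext z; by_cases h : z = 0 <;> simp [cayley, h]

lemma cayley_star (f : ℝ → ℂ) : cayley (star f) = fun z => star (cayley f z) := by
  ext z; by_cases h : z = 0 <;> simp [cayley, h]

/-- The functional calculus as a `*`-homomorphism. -/
def fcHom : S →⋆ₙₐ[ℂ] 𝓜(ℂ, B) where
  toFun f := D.fc f
  map_smul' c f := by
    change cfc (cayley (c • ⇑f)) _ = c • cfc (cayley f) _
    rw [cayley_smul, cfc_const_mul _ _ _ (D.continuousOn_cayley f)]
  map_zero' := by
    change cfc (cayley (0 : ℝ → ℂ)) D.resolvent = 0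
    have : cayley (0 : ℝ → ℂ) = fun _ => 0 := by ext z; simp [cayley]
    rw [this, cfc_const_zero]
  map_add' f g := by
    change cfc (cayley (⇑f + ⇑g)) _ = cfc (cayley f) _ + cfc (cayley g) _
    rw [cayley_add, cfc_add _ _ _ (D.continuousOn_cayley f) (D.continuousOn_cayley g)]
  map_mul' f g := by
    change cfc (cayley (⇑f * ⇑g)) _ = cfc (cayley f) _ * cfc (cayley g) _
    rw [cayley_mul, cfc_mul _ _ _ (D.continuousOn_cayley f) (D.continuousOn_cayley g)]
  map_star' f := by
    change cfc (cayley (star ⇑f)) _ = star (cfc (cayley f) _)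
    rw [cayley_star, cfc_star]

/-- Rescaling `f ↦ f(r ·)` on `C₀(ℝ)` for `r ≠ 0`. -/
def scale (r : ℝ) (hr : r ≠ 0) (f : S) : S where
  toFun x := f (r * x)
  continuous_toFun := by fun_prop
  zero_at_infty' := (zero_at_infty f).comp
    (Homeomorph.mulLeft₀ r hr).isClosedEmbedding.tendsto_cocompact

/-- The `*`-homomorphism `f ↦ f(r D)`, which is `f ↦ f(0)` for `r = 0`. -/
def scaledFc (r : ℝ) : S →⋆ₙₐ[ℂ] 𝓜(ℂ, B) :=
  if hr : r = 0 then
    { toFun := fun f => f 0 • 1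
      map_smul' := fun c f => by simp [mul_smul]
      map_zero' := by simp
      map_add' := fun f g => by simp [add_smul]
      map_mul' := fun f g => by
        rw [ZeroAtInftyContinuousMap.mul_apply, smul_mul_smul_comm, one_mul]
      map_star' := fun f => by simp }
  else
    D.fcHom.comp
      { toFun := scale r hr
        map_smul' := fun c f => rfl
        map_zero' := rfl
        map_add' := fun f g => rfl
        map_mul' := fun f g => rfl
        map_star' := fun f => rfl }

lemma scaledFc_zero (f : S) : D.scaledFc 0 f = f 0 • 1 := by
  rw [scaledFc, dif_pos rfl]
  rfl

lemma scaledFc_of_ne {r : ℝ} (hr : r ≠ 0) (f : S) :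
    D.scaledFc r f = D.fcHom (scale r hr f) := by
  rw [scaledFc, dif_neg hr]
  rfl

lemma scaledFc_eq_fc {r : ℝ} (hr : r ≠ 0) (f : S) :
    D.scaledFc r f = D.fc fun x => f (r * x) :=
  D.scaledFc_of_ne hr f

lemma norm_scaledFc_le (r : ℝ) (f : S) : ‖D.scaledFc r f‖ ≤ ‖f‖ :=
  NonUnitalStarAlgHom.norm_apply_le _ f

/-- The functional calculus of the zero multiplier is evaluation at `0`. -/
lemma zero_fc (f : ℝ → ℂ) : (0 : UMultiplier B).fc f = f 0 • 1 := by
  have hres : (0 : UMultiplier B).resolvent = algebraMap ℂ 𝓜(ℂ, B) (-Complex.I) := by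
    refine multiplier_ext fun b => ?_
    rw [resolvent_fst, Algebra.algebraMap_eq_smul_one, DoubleCentralizer.smul_fst,
      DoubleCentralizer.one_fst]
    have h := (0 : UMultiplier B).resPlus_shift ⟨(-Complex.I) • b, trivial⟩
    have h0 : (0 : UMultiplier B).op ⟨(-Complex.I) • b, trivial⟩ = 0 := LinearPMap.zero_apply _
    rw [h0, zero_add, smul_smul] at h
    simpa using h
  rw [fc_eq, hres, cfc_algebraMap, Algebra.algebraMap_eq_smul_one]
  simp [cayley]

/-! #### Strong continuity of `r ↦ f(r D)` -/

/-- The function `x ↦ (x + i)⁻¹` in `C₀(ℝ)`. -/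
def resolventFun : S where
  toFun x := ((x : ℂ) + Complex.I)⁻¹
  continuous_toFun := by
    refine Continuous.inv₀ (by fun_prop) fun x h => ?_
    have := congrArg Complex.im h
    simp at this
  zero_at_infty' := by
    refine tendsto_inv₀_cobounded.comp ?_
    rw [← tendsto_norm_atTop_iff_cobounded]
    refine tendsto_atTop_mono (f := fun x : ℝ => ‖x‖) (fun x => ?_) ?_
    · have := Complex.abs_re_le_norm ((x : ℂ) + Complex.I)
      simpa using this
    · rw [← Metric.cobounded_eq_cocompact]
      exact tendsto_norm_cobounded_atTop

lemma fcHom_resolventFun : D.fcHom resolventFun = D.resolvent := D.fc_resolvent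

/-- The function `x ↦ f(r x) (x + i)⁻¹`. -/
def scaleMulResolvent (f : S) (r : ℝ) : S where
  toFun x := f (r * x) * resolventFun x
  continuous_toFun := by fun_prop
  zero_at_infty' := by
    refine (zero_at_infty resolventFun).zero_mul_isBoundedUnder_le ?_ |>.congr fun x => mul_comm _ _
    exact isBoundedUnder_of ⟨‖f‖, fun x => f.toBCF.norm_coe_le_norm _⟩

/-- The dilations `f(r ·)` need not be norm continuous at `r = 0`; the decaying factor repairs this.
Outside a bounded set the difference is at most `2 ‖f‖` times a small number, and on the bounded set
the uniform continuity of `f` suffices. -/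
lemma continuous_scaleMulResolvent (f : S) : Continuous (scaleMulResolvent f) := by
  rw [Metric.continuous_iff]
  intro r ε hε
  have hR : ∀ᶠ x in cocompact ℝ, ‖resolventFun x‖ * (2 * ‖f‖) < ε / 2 := by
    have h := ((zero_at_infty resolventFun).norm.mul_const (2 * ‖f‖))
    rw [norm_zero, zero_mul] at h
    exact h.eventually_lt_const (half_pos hε)
  rw [← Metric.cobounded_eq_cocompact, ← comap_norm_atTop, eventually_comap] at hR
  obtain ⟨M, hM⟩ := eventually_atTop.1 hR
  have hρ := norm_nonneg resolventFun
  obtain ⟨δ, hδ, hf⟩ := Metric.uniformContinuous_iff.1 (ZeroAtInftyContinuousMap.uniformContinuous f)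
    (ε / 2 / (‖resolventFun‖ + 1)) (by positivity)
  -- On `|x| ≤ |M| + 1` this makes `|s x - r x| < δ`.
  refine ⟨δ / (|M| + 1), by positivity, fun s hs => ?_⟩
  rw [← ZeroAtInftyContinuousMap.dist_toBCF_eq_dist]
  refine lt_of_le_of_lt ((BoundedContinuousFunction.dist_le (half_pos hε).le).2 fun x => ?_)
    (half_lt_self hε)
  change dist (f (s * x) * resolventFun x) (f (r * x) * resolventFun x) ≤ ε / 2
  rw [dist_eq_norm, ← sub_mul, norm_mul]
  have hnf : ∀ y, ‖f y‖ ≤ ‖f‖ := fun y => f.toBCF.norm_coe_le_norm y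
  have hnr : ‖resolventFun x‖ ≤ ‖resolventFun‖ := resolventFun.toBCF.norm_coe_le_norm x
  by_cases hx : M ≤ ‖x‖
  · refine le_trans ?_ (hM _ hx x rfl).le
    rw [mul_comm]
    refine mul_le_mul_of_nonneg_left ((norm_sub_le _ _).trans ?_) (norm_nonneg _)
    linarith [hnf (s * x), hnf (r * x)]
  · have hx' : |x| ≤ |M| + 1 := by
      rw [not_le, Real.norm_eq_abs] at hx
      linarith [le_abs_self M]
    have hd : dist (s * x) (r * x) < δ := by
      rw [Real.dist_eq, ← sub_mul, abs_mul]
      rw [Real.dist_eq, lt_div_iff₀ (by positivity)] at hs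
      exact lt_of_le_of_lt (mul_le_mul_of_nonneg_left hx' (abs_nonneg _)) hs
    have h := (hf hd).le
    rw [dist_eq_norm] at h
    calc ‖f (s * x) - f (r * x)‖ * ‖resolventFun x‖
        ≤ ε / 2 / (‖resolventFun‖ + 1) * (‖resolventFun‖ + 1) :=
          mul_le_mul h (by linarith) (norm_nonneg _) (by positivity)
      _ = ε / 2 := div_mul_cancel₀ _ (by positivity)

/-- This puts `r = 0` and `r ≠ 0` on the same footing: the scalar `f 0` becomes the functional
calculus of `f(0) (x + i)⁻¹` once multiplied by the resolvent. -/
lemma scaledFc_mul_resolvent (f : S) (r : ℝ) :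
    D.scaledFc r f * D.resolvent = D.fcHom (scaleMulResolvent f r) := by
  by_cases hr : r = 0
  · subst hr
    rw [scaledFc_zero, smul_mul_assoc, one_mul, ← fcHom_resolventFun, ← map_smul]
    congr 1
    ext x
    simp [scaleMulResolvent]
  · rw [scaledFc_of_ne _ hr, ← fcHom_resolventFun, ← map_mul]
    rfl

/-- The range of `(D + i)⁻¹` contains the domain of `D`. -/
lemma denseRange_resPlus : DenseRange D.resPlus := by
  refine D.dense.mono fun x hx => ⟨_, D.resPlus_shift ⟨x, hx⟩⟩

/-- For `b` in the range of `(D + i)⁻¹` this is the norm continuity of `f(r D) (D + i)⁻¹`. That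
range is dense and `‖f(r D)‖ ≤ ‖f‖` for all `r`, so a general `b` gives a uniform limit of
continuous functions. -/
lemma continuous_scaledFc_fst (f : S) (b : B) : Continuous fun r => (D.scaledFc r f).fst b := by
  have hcont : Continuous D.fcHom := AddMonoidHomClass.continuous_of_bound D.fcHom 1 fun f => by
    rw [one_mul]
    exact NonUnitalStarAlgHom.norm_apply_le _ f
  have heval : ∀ c : B, Continuous fun T : 𝓜(ℂ, B) => T.fst c := fun c =>
    AddMonoidHomClass.continuous_of_bound
      (⟨⟨fun T : 𝓜(ℂ, B) => T.fst c, rfl⟩, fun _ _ => rfl⟩ : 𝓜(ℂ, B) →+ B) ‖c‖ fun T => by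
      rw [mul_comm, ← DoubleCentralizer.norm_fst]
      exact T.fst.le_opNorm c
  refine continuous_of_uniform_approx_of_continuous fun u hu => ?_
  obtain ⟨ε, hε, hu⟩ := Metric.mem_uniformity_dist.1 hu
  have hf := norm_nonneg f
  obtain ⟨c, hc⟩ := D.denseRange_resPlus.exists_dist_lt b
    (show 0 < ε / (‖f‖ + 1) by positivity)
  refine ⟨fun r => (D.scaledFc r f * D.resolvent).fst c, ?_, fun r => hu ?_⟩
  · simp_rw [scaledFc_mul_resolvent]
    exact (heval c).comp (hcont.comp (continuous_scaleMulResolvent f))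
  · change dist ((D.scaledFc r f).fst b) ((D.scaledFc r f).fst (D.resPlus c)) < ε
    rw [dist_eq_norm, ← map_sub]
    refine lt_of_le_of_lt ((D.scaledFc r f).fst.le_opNorm _) ?_
    rw [DoubleCentralizer.norm_fst]
    rw [dist_eq_norm, lt_div_iff₀ (by positivity)] at hc
    nlinarith [D.norm_scaledFc_le r f, norm_nonneg (b - D.resPlus c)]

/-- Formally, `γ (D + i)⁻¹ γ = (-D + i)⁻¹ = -(D - i)⁻¹`, and `(D - i)⁻¹` is the adjoint of `(D +
i)⁻¹`. -/
lemma IsOdd.γ_resolvent [Grading B] {D : UMultiplier B} (hD : D.IsOdd) :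
    Grading.γ D.resolvent = -star D.resolvent := by
  refine multiplier_ext fun b => ?_
  obtain ⟨x, rfl⟩ := D.shift_surjective star_neg_I star_neg_I_mul b
  obtain ⟨hx, hDx⟩ := hD x
  rw [DoubleCentralizer.neg_fst]
  change Grading.γ (D.resPlus (Grading.γ (D.shift (-Complex.I) x))) =
    -(star D.resolvent).fst (D.shift (-Complex.I) x)
  have h1 := D.resPlus_shift ⟨_, hx⟩
  rw [star_resolvent_fst, shift_apply, resMinus_shift, map_add, map_smul,
    ← neg_neg (Grading.γ (D.op x)), ← hDx, neg_smul, ← neg_add, map_neg]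
  rw [h1, map_neg, Grading.γ_γ]

/-- For odd `D` the functional calculus is graded. -/
lemma IsOdd.isGraded_fcHom [Grading B] {D : UMultiplier B} (hD : D.IsOdd) : IsGraded D.fcHom := by
  intro f
  let Γ : 𝓜(ℂ, B) ≃⋆ₐ[ℂ] 𝓜(ℂ, B) := Grading.γ
  have hΓ : Continuous Γ := continuous_γ
  have h : Γ (D.fcHom f) = cfc (cayley f) (Γ D.resolvent) :=
    StarAlgHomClass.map_cfc Γ (cayley f) D.resolvent (D.continuousOn_cayley f) hΓ
      inferInstance (inferInstance)
  -- Under `z = (x + i)⁻¹` the reflection `x ↦ -x` becomes `z ↦ -star z`. Thus the grading of `S`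
  -- and that of `M(B)` both amount to precomposition with this map. It preserves the spectrum
  -- because `Γ` is an automorphism, which supplies the continuity needed to compose.
  have hneg : cfc (fun z : ℂ => -star z) D.resolvent = Γ D.resolvent := by
    rw [cfc_neg, cfc_star_id (R := ℂ) D.resolvent]
    exact hD.γ_resolvent.symm
  have hspec : (fun z : ℂ => -star z) '' spectrum ℂ D.resolvent = spectrum ℂ D.resolvent := by
    rw [← cfc_map_spectrum (R := ℂ) (fun z : ℂ => -star z) D.resolvent, hneg]
    exact AlgEquiv.spectrum_eq Γ D.resolvent
  change cfc (cayley fun x => f (-x)) D.resolvent = Γ (D.fcHom f)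
  rw [h, ← hneg, ← cfc_comp' (cayley f) (fun z : ℂ => -star z) D.resolvent
    (by rw [hspec]; exact D.continuousOn_cayley f)]
  refine congrArg (cfc · D.resolvent) ?_
  ext z
  by_cases hz : z = 0 <;> simp [cayley, hz]

lemma IsOdd.isGraded_scaledFc [Grading B] {D : UMultiplier B} (hD : D.IsOdd) (r : ℝ) :
    IsGraded (D.scaledFc r) := by
  intro f
  by_cases hr : r = 0
  · subst hr
    rw [scaledFc_zero, scaledFc_zero, map_smul, map_one]
    congr 1
    change f (-0) = f 0
    rw [neg_zero]
  · rw [scaledFc_of_ne _ hr, scaledFc_of_ne _ hr, ← hD.isGraded_fcHom]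
    congr 1
    ext x
    change f (-(r * x)) = f (r * -x)
    rw [mul_neg]

end UMultiplier

/-! ### Asymptotic boundedness and asymptotic equivalence -/

section aux

variable {A B C : Type*} [NonUnitalCStarAlgebra A] [NonUnitalCStarAlgebra B] [NonUnitalCStarAlgebra C]

/-- Take `k = 1 - √(1 - h)`, so that `(1 - k)² = 1 - h`. Since `A` need not have a unit, the
identity is multiplied out and the non-unital calculus is applied to a function vanishing at `0`. -/
lemma exists_quasi_sqrt {h : A} (hh : IsSelfAdjoint h) (h1 : ‖h‖ ≤ 1) :
    ∃ k : A, star k = k ∧ h + k * k = k + k := by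
  let g : ℝ → ℝ := fun x => 1 - √(1 - x)
  have hg : Continuous g := by fun_prop
  have hg0 : g 0 = 0 := by simp [g]
  refine ⟨cfcₙ g h, (IsSelfAdjoint.cfcₙ (f := g) (a := h)).star_eq, ?_⟩
  rw [← cfcₙ_mul g g h hg.continuousOn hg0 hg.continuousOn hg0,
    ← cfcₙ_add g g h hg.continuousOn hg0 hg.continuousOn hg0]
  have hadd : h + cfcₙ (fun x => g x * g x) h = cfcₙ (fun x => x + g x * g x) h := by
    rw [cfcₙ_add (fun x => x) (fun x => g x * g x) h (by fun_prop) rfl (by fun_prop) (by simp [hg0]),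
      cfcₙ_id' ℝ h]
  rw [hadd]
  refine cfcₙ_congr fun x hx => ?_
  -- Ensures `1 - x ≥ 0`, so the value `0` of the real square root at negative numbers plays no
  -- role.
  have hx1 : x ≤ 1 := by
    have := norm_apply_le_norm_cfcₙ (fun x : ℝ => x) h hx
    rw [cfcₙ_id' ℝ h] at this
    exact (le_abs_self x).trans (this.trans h1)
  have hs := Real.mul_self_sqrt (sub_nonneg.2 hx1)
  simp only [g]
  linear_combination hs

lemma norm_le_norm_star_mul_self_add (x y : B) :
    ‖x‖ * ‖x‖ ≤ ‖star x * x + star y * y‖ := by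
  let _ := CStarAlgebra.spectralOrder B
  let _ := CStarAlgebra.spectralOrderedRing B
  rw [← CStarRing.norm_star_mul_self]
  exact CStarAlgebra.norm_le_norm_of_nonneg_of_le (star_mul_self_nonneg x)
    (le_add_of_nonneg_right (star_mul_self_nonneg y))

lemma isometry_const : Isometry (ContinuousMap.const unitInterval : B → C(unitInterval, B)) := by
  refine Isometry.of_dist_eq fun a b => le_antisymm
    ((ContinuousMap.dist_le dist_nonneg).2 fun _ => le_rfl) ?_
  exact ContinuousMap.dist_apply_le_dist (f := .const unitInterval a) (g := .const unitInterval b) 0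

lemma tendsto_constMap {f : Ray → B} (hf : Tendsto f atTop (𝓝 0)) :
    Tendsto (fun t => ContinuousMap.const unitInterval (f t)) atTop (𝓝 0) :=
  (isometry_const.continuous.tendsto (0 : B)).comp hf

/-- Multiplication by the coordinate function of the unit interval. -/
def coordMul : B →L[ℝ] C(unitInterval, B) :=
  LinearMap.mkContinuous
    { toFun := fun b => ⟨fun s => (s : ℝ) • b, by fun_prop⟩
      map_add' := fun a b => by ext s; simp
      map_smul' := fun c a => by ext s; exact smul_comm _ _ _ } 1 fun b => by
    rw [one_mul]
    refine (ContinuousMap.norm_le _ (norm_nonneg b)).2 fun s => ?_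
    change ‖(s : ℝ) • b‖ ≤ ‖b‖
    rw [norm_smul, Real.norm_of_nonneg s.2.1]
    exact mul_le_of_le_one_left (norm_nonneg b) s.2.2

lemma continuous_starAlgEquiv (θ : B ≃⋆ₐ[ℂ] C) : Continuous θ :=
  AddMonoidHomClass.continuous_of_bound θ 1 fun a => by
    rw [one_mul]
    exact NonUnitalStarAlgHom.norm_apply_le θ a

/-- Pointwise application of a `*`-isomorphism. -/
def pointwise (θ : B ≃⋆ₐ[ℂ] C) : C(unitInterval, B) ≃⋆ₐ[ℂ] C(unitInterval, C) :=
  { toFun := fun f => (⟨θ, continuous_starAlgEquiv θ⟩ : C(B, C)).comp f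
    invFun := fun f => (⟨θ.symm, continuous_starAlgEquiv θ.symm⟩ : C(C, B)).comp f
    left_inv := fun f => by ext x; simp
    right_inv := fun f => by ext x; simp
    map_mul' := fun f g => by ext x; simp
    map_add' := fun f g => by ext x; simp
    map_star' := fun f => by ext x; simp [map_star]
    map_smul' := fun c f => by ext x; simp }

end aux

namespace AsymptoticMorphism

variable {A B C : Type*} [NonUnitalCStarAlgebra A] [Grading A] [NonUnitalCStarAlgebra B] [Grading B]
  [NonUnitalCStarAlgebra C] [Grading C]

lemma tendsto_zero (Φ : AsymptoticMorphism A B) : Tendsto (fun t => Φ.toFun t 0) atTop (𝓝 0) := by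
  have := (Φ.add_smul 0 0 1).neg
  rw [neg_zero] at this
  exact this.congr fun t => by simp

lemma tendsto_add (Φ : AsymptoticMorphism A B) (a b : A) :
    Tendsto (fun t => Φ.toFun t (a + b) - (Φ.toFun t a + Φ.toFun t b)) atTop (𝓝 0) :=
  (Φ.add_smul a b 1).congr fun t => by simp [sub_sub]

lemma tendsto_smul (Φ : AsymptoticMorphism A B) (c : ℂ) (a : A) :
    Tendsto (fun t => Φ.toFun t (c • a) - c • Φ.toFun t a) atTop (𝓝 0) := by
  have := (Φ.add_smul 0 a c).add Φ.tendsto_zero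
  rw [add_zero] at this
  refine this.congr fun t => ?_
  rw [zero_add]
  abel

lemma tendsto_sub (Φ : AsymptoticMorphism A B) (a b : A) :
    Tendsto (fun t => Φ.toFun t (a - b) - (Φ.toFun t a - Φ.toFun t b)) atTop (𝓝 0) :=
  (Φ.add_smul a b (-1)).congr fun t => by rw [neg_one_smul, neg_one_smul, ← sub_eq_add_neg]; abel

/-- No bound is assumed of an asymptotic morphism, but a relation forces one. With `k` self-adjoint
and `x* x + k² = 2 k`, the images `X` and `u` of `x` and `k` satisfy `X* X + u* u ≈ 2 u`. The left
side has norm at least `‖X‖²` and `‖u‖²`, while the right side is linear in `‖u‖`. -/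
lemma eventually_norm_le_four (Φ : AsymptoticMorphism A B) {x : A} (hx : ‖x‖ ≤ 1) :
    ∀ᶠ t in atTop, ‖Φ.toFun t x‖ ≤ 4 := by
  obtain ⟨k, hk, hxk⟩ := exists_quasi_sqrt (IsSelfAdjoint.star_mul_self x)
    (by rw [CStarRing.norm_star_mul_self]; exact mul_le_one₀ hx (norm_nonneg x) hx)
  have hev : ∀ {f : Ray → B}, Tendsto f atTop (𝓝 0) → ∀ᶠ t in atTop, ‖f t‖ ≤ 1 / 5 := fun hf => by
    filter_upwards [(Metric.tendsto_nhds.1 hf) (1 / 5) (by norm_num)] with t ht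
    rw [dist_zero_right] at ht
    exact ht.le
  have h6 := Φ.star k
  rw [hk] at h6
  filter_upwards [hev (Φ.mul (Star.star x) x), hev (Φ.star x), hev (Φ.tendsto_add (Star.star x * x) (k * k)),
    hev (Φ.tendsto_add k k), hev (Φ.mul k k), hev h6] with t h1 h2 h3 h4 h5 h6
  rw [hxk] at h3
  set X := Φ.toFun t x
  set u := Φ.toFun t k
  -- An exact identity with six asymptotically vanishing discrepancies, each of norm at most `1 /
  -- 5`. Four occur alone and contribute `4 / 5`; the other two are multiplied by `X` and by `u`.
  have key : Star.star X * X + Star.star u * u = (u + u) +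
      ((Φ.toFun t (k + k) - (u + u)) - (Φ.toFun t (k + k) - (Φ.toFun t (Star.star x * x) + Φ.toFun t (k * k)))
      - (Φ.toFun t (Star.star x * x) - Φ.toFun t (Star.star x) * X) - (Φ.toFun t (Star.star x) - Star.star X) * X
      - (Φ.toFun t (k * k) - u * u) - (u - Star.star u) * u) := by noncomm_ring
  have hle : ‖Star.star X * X + Star.star u * u‖ ≤ 2 * ‖u‖ + (4 / 5 + 1 / 5 * ‖X‖ + 1 / 5 * ‖u‖) := by
    rw [key]
    refine (norm_add_le _ _).trans (add_le_add ((norm_add_le _ _).trans (two_mul _).ge) ?_)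
    have e1 := (norm_mul_le (Φ.toFun t (Star.star x) - Star.star X) X).trans
      (mul_le_mul_of_nonneg_right h2 (norm_nonneg X))
    have e2 := (norm_mul_le (u - Star.star u) u).trans (mul_le_mul_of_nonneg_right h6 (norm_nonneg u))
    refine (norm_sub_le _ _).trans ?_
    refine (add_le_add_left (norm_sub_le _ _) _).trans ?_
    refine (add_le_add_left (add_le_add_left (norm_sub_le _ _) _) _).trans ?_
    refine (add_le_add_left (add_le_add_left (add_le_add_left (norm_sub_le _ _) _) _) _).trans ?_
    refine (add_le_add_left (add_le_add_left (add_le_add_left (add_le_add_left (norm_sub_le _ _) _) _) _) _).trans ?_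
    linarith
  have hX := (norm_le_norm_star_mul_self_add X u).trans hle
  have hu := (norm_le_norm_star_mul_self_add u X).trans ((congrArg norm (add_comm _ _)).trans_le hle)
  have hX0 := norm_nonneg X
  have hu0 := norm_nonneg u
  -- The larger norm `m` satisfies `m² ≤ 12 m / 5 + 4 / 5`, which fails for `m > 4`.
  by_contra! hcon
  rcases le_total ‖X‖ ‖u‖ with hc | hc <;> nlinarith

/-- Rescaling to the unit ball; the `ε` is there because homogeneity holds only asymptotically. -/
lemma eventually_norm_le (Φ : AsymptoticMorphism A B) (x : A) {ε : ℝ} (hε : 0 < ε) :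
    ∀ᶠ t in atTop, ‖Φ.toFun t x‖ ≤ 4 * ‖x‖ + ε := by
  obtain ⟨y, hy, hxy⟩ : ∃ y : A, ‖y‖ ≤ 1 ∧ x = (‖x‖ : ℂ) • y := by
    by_cases hx : x = 0
    · exact ⟨0, by simp, by simp [hx]⟩
    · have hn : (‖x‖ : ℂ) ≠ 0 := by simpa using hx
      refine ⟨(‖x‖ : ℂ)⁻¹ • x, ?_, by rw [smul_inv_smul₀ hn]⟩
      rw [norm_smul, norm_inv, Complex.norm_real, norm_norm, inv_mul_cancel₀ (by simpa using hx)]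
  filter_upwards [Φ.eventually_norm_le_four hy,
    (Metric.tendsto_nhds.1 (Φ.tendsto_smul (‖x‖ : ℂ) y)) ε hε] with t h1 h2
  rw [dist_zero_right, ← hxy] at h2
  have h3 := norm_add_le (Φ.toFun t x - (‖x‖ : ℂ) • Φ.toFun t y) ((‖x‖ : ℂ) • Φ.toFun t y)
  rw [sub_add_cancel, norm_smul, Complex.norm_real, norm_norm] at h3
  nlinarith [norm_nonneg x]

/-- Asymptotic equivalence of asymptotic morphisms. -/
def AsympEquiv (Φ Ψ : AsymptoticMorphism A B) : Prop :=
  ∀ a, Tendsto (fun t => Φ.toFun t a - Ψ.toFun t a) atTop (𝓝 0)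

/-- Asymptotic morphisms which agree on elementary tensors are asymptotically equivalent. -/
lemma AsympEquiv.of_tmul {Φ Ψ : AsymptoticMorphism (GTensor A B) C}
    (h : ∀ a b, Tendsto (fun t => Φ.toFun t (.tmul a b) - Ψ.toFun t (.tmul a b)) atTop (𝓝 0)) :
    Φ.AsympEquiv Ψ := by
  have hof : ∀ x : AlgTensor A B,
      Tendsto (fun t => Φ.toFun t (.of x) - Ψ.toFun t (.of x)) atTop (𝓝 0) := fun x => by
    induction x using AlgTensor.induction' with
    | h0 =>
      rw [GTensor.of_zero]
      simpa using Φ.tendsto_zero.sub Ψ.tendsto_zero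
    | ht a b => exact h a b
    | ha x y hx hy =>
      rw [GTensor.of_add]
      have := ((Φ.tendsto_add (.of x) (.of y)).sub (Ψ.tendsto_add (.of x) (.of y))).add (hx.add hy)
      rw [add_zero, sub_zero, add_zero] at this
      exact this.congr fun t => by abel
  intro X
  rw [Metric.tendsto_nhds]
  intro ε hε
  -- With `‖X - x‖ < ε / 32`, each of `Φ` and `Ψ` has norm below `4 ε / 32 + ε / 8 = ε / 4` at `X -
  -- x`. Together with the three further errors of size `ε / 8` this stays below `ε`.
  obtain ⟨x, hx⟩ := GTensor.denseRange_of.exists_dist_lt X (show 0 < ε / 32 by positivity)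
  rw [dist_eq_norm] at hx
  have hε' : 0 < ε / 8 := by positivity
  filter_upwards [Φ.eventually_norm_le (X - .of x) hε', Ψ.eventually_norm_le (X - .of x) hε',
    Metric.tendsto_nhds.1 (Φ.tendsto_sub X (.of x)) _ hε',
    Metric.tendsto_nhds.1 (Ψ.tendsto_sub X (.of x)) _ hε',
    Metric.tendsto_nhds.1 (hof x) _ hε'] with t h1 h2 h3 h4 h5
  rw [dist_zero_right] at *
  have key : Φ.toFun t X - Ψ.toFun t X = Φ.toFun t (X - .of x)
      - (Φ.toFun t (X - .of x) - (Φ.toFun t X - Φ.toFun t (.of x)))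
      - Ψ.toFun t (X - .of x) + (Ψ.toFun t (X - .of x) - (Ψ.toFun t X - Ψ.toFun t (.of x)))
      + (Φ.toFun t (.of x) - Ψ.toFun t (.of x)) := by abel
  rw [key]
  refine lt_of_le_of_lt (norm_add_le _ _) ?_
  refine lt_of_le_of_lt (add_le_add_left (norm_add_le _ _) _) ?_
  refine lt_of_le_of_lt (add_le_add_left (add_le_add_left (norm_sub_le _ _) _) _) ?_
  refine lt_of_le_of_lt
    (add_le_add_left (add_le_add_left (add_le_add_left (norm_sub_le _ _) _) _) _) ?_
  linarith

lemma isBoundedUnder (Φ : AsymptoticMorphism A B) (a : A) :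
    IsBoundedUnder (· ≤ ·) atTop fun t => ‖Φ.toFun t a‖ :=
  ⟨_, eventually_map.2 (Φ.eventually_norm_le a one_pos)⟩

/-- A continuous family asymptotic to an asymptotic morphism is an asymptotic morphism. -/
def perturb (Φ : AsymptoticMorphism A B) (F : Ray → A → B) (hc : ∀ a, Continuous fun t => F t a)
    (hF : ∀ a, Tendsto (fun t => F t a - Φ.toFun t a) atTop (𝓝 0)) : AsymptoticMorphism A B where
  toFun := F
  continuous := hc
  add_smul a b c := by
    have := (((hF (a + c • b)).sub (hF a)).sub ((hF b).const_smul c)).add (Φ.add_smul a b c)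
    simp only [smul_zero, sub_zero, add_zero] at this
    refine this.congr fun t => ?_
    rw [smul_sub]
    abel
  mul a b := by
    -- The cross terms vanish only because `Φ` is asymptotically bounded.
    have h1 := (hF a).zero_mul_isBoundedUnder_le (Φ.isBoundedUnder b)
    have h2 := isBoundedUnder_le_mul_tendsto_zero (Φ.isBoundedUnder a) (hF b)
    have := (((hF (a * b)).add (Φ.mul a b)).sub h1).sub (h2.add ((hF a).mul (hF b)))
    simp only [mul_zero, sub_zero, add_zero] at this
    refine this.congr fun t => ?_
    noncomm_ring
  star a := by
    have := ((hF (Star.star a)).add (Φ.star a)).sub (hF a).star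
    simp only [star_zero, sub_zero, add_zero] at this
    refine this.congr fun t => ?_
    rw [star_sub]
    abel
  graded a := by
    have h := (continuous_γ.tendsto (0 : B)).comp (hF a)
    rw [map_zero] at h
    have := ((hF (Grading.γ a)).add (Φ.graded a)).sub h
    simp only [sub_zero, add_zero] at this
    refine this.congr fun t => ?_
    simp only [Function.comp_apply, map_sub]
    abel

/-- The constant homotopy. -/
def constHomotopy (Φ : AsymptoticMorphism A B) : AsymptoticMorphism A C(unitInterval, B) where
  toFun t a := .const unitInterval (Φ.toFun t a)
  continuous a := isometry_const.continuous.comp (Φ.continuous a)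
  add_smul a b c := tendsto_constMap (Φ.add_smul a b c)
  mul a b := tendsto_constMap (Φ.mul a b)
  star a := tendsto_constMap (Φ.star a)
  graded a := tendsto_constMap (Φ.graded a)

/-- Asymptotically equivalent asymptotic morphisms are homotopic. -/
lemma AsympEquiv.homotopic {Φ Ψ : AsymptoticMorphism A B} (h : Φ.AsympEquiv Ψ) :
    Homotopic Φ Ψ := by
  -- The straight line `Φ + s (Ψ - Φ)`: it differs from the constant homotopy by a term vanishing
  -- uniformly in `s`, so it is again an asymptotic morphism, with the prescribed endpoints for
  -- every `t`.
  refine ⟨Φ.constHomotopy.perturb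
    (fun t a => Φ.constHomotopy.toFun t a + coordMul (Ψ.toFun t a - Φ.toFun t a))
    (fun a => ?_) (fun a => ?_), fun t a => ⟨?_, ?_⟩⟩
  · exact (Φ.constHomotopy.continuous a).add
      (coordMul.continuous.comp ((Ψ.continuous a).sub (Φ.continuous a)))
  · have h1 := (h a).neg
    rw [neg_zero] at h1
    have := (coordMul.continuous.tendsto (0 : B)).comp h1
    rw [map_zero] at this
    refine this.congr fun t => ?_
    rw [add_sub_cancel_left, Function.comp_apply, neg_sub]
  · change Φ.toFun t a + (0 : ℝ) • (Ψ.toFun t a - Φ.toFun t a) = _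
    rw [zero_smul, add_zero]
  · change Φ.toFun t a + (1 : ℝ) • (Ψ.toFun t a - Φ.toFun t a) = _
    rw [one_smul, add_sub_cancel]

lemma AsympEquiv.map {Φ Ψ : AsymptoticMorphism A B} (h : Φ.AsympEquiv Ψ) (θ : B ≃⋆ₐ[ℂ] C)
    (hθ : IsGraded θ) : (Φ.map θ hθ).AsympEquiv (Ψ.map θ hθ) := fun a => by
  have := ((continuous_starAlgEquiv θ).tendsto 0).comp (h a)
  rw [map_zero] at this
  exact this.congr fun t => map_sub θ _ _

lemma Homotopic.map {Φ Ψ : AsymptoticMorphism A B} (h : Homotopic Φ Ψ) (θ : B ≃⋆ₐ[ℂ] C)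
    (hθ : IsGraded θ) : Homotopic (Φ.map θ hθ) (Ψ.map θ hθ) := by
  obtain ⟨H, hH⟩ := h
  refine ⟨H.map (pointwise θ) fun f => ?_, fun t a => ⟨?_, ?_⟩⟩
  · ext s
    exact hθ (f s)
  · exact congrArg θ (hH t a).1
  · exact congrArg θ (hH t a).2

/-- Evaluation of a family of functions on the unit interval. -/
def eval (s : unitInterval) (H : AsymptoticMorphism A C(unitInterval, B)) :
    AsymptoticMorphism A B :=
  have h0 : Tendsto (fun f : C(unitInterval, B) => f s) (𝓝 0) (𝓝 0) :=
    (continuous_eval_const s).tendsto 0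
  { toFun := fun t a => H.toFun t a s
    continuous := fun a => (continuous_eval_const s).comp (H.continuous a)
    add_smul := fun a b c => h0.comp (H.add_smul a b c)
    mul := fun a b => h0.comp (H.mul a b)
    star := fun a => h0.comp (H.star a)
    graded := fun a => h0.comp (H.graded a) }

end AsymptoticMorphism

/-! ### Graded commutators -/

section commutators

variable {A B M : Type*} [NonUnitalCStarAlgebra A] [Grading A] [NonUnitalCStarAlgebra B] [Grading B]
  [NonUnitalCStarAlgebra M] [Grading M]

lemma gradedCommutator_of_even (x : M) {y : M} (hy : Grading.γ y = y) :
    gradedCommutator x y = x * y - y * x := by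
  rw [gradedCommutator, evenPart_of_even hy, oddPart_of_even hy, zero_mul, add_zero]

lemma gradedCommutator_of_odd (x : M) {y : M} (hy : Grading.γ y = -y) :
    gradedCommutator x y = x * y - y * Grading.γ x := by
  rw [gradedCommutator, evenPart_of_odd hy, oddPart_of_odd hy, zero_mul, zero_add]

variable {T : B →⋆ₙₐ[ℂ] M} {ψ : A →⋆ₙₐ[ℂ] M}

/-- The failure of `f ⊗ a ↦ T f * ψ a` to be multiplicative, in terms of graded commutators. -/
lemma map_tmul_mul_sub (hT : IsGraded T) (hψ : IsGraded ψ) (f g : B) (a b : A) :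
    T (f * g) * ψ (evenPart A a * b) + T (f * Grading.γ g) * ψ (oddPart A a * b)
      - T f * ψ a * (T g * ψ b) =
    T f * (gradedCommutator (T g) (ψ (evenPart A a))
      + gradedCommutator (T (Grading.γ g)) (ψ (oddPart A a))) * ψ b := by
  rw [gradedCommutator_of_even _ (by rw [← hψ, γ_even]),
    gradedCommutator_of_odd _ (by rw [← hψ, γ_odd, map_neg]), ← hT, Grading.γ_γ]
  have ha : ψ a = ψ (evenPart A a) + ψ (oddPart A a) := by rw [← map_add, even_add_odd]
  rw [ha]
  simp only [map_mul]
  noncomm_ring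

/-- The failure of `f ⊗ a ↦ T f * ψ a` to be involutive, in terms of graded commutators. -/
lemma map_tmul_star_sub (hT : IsGraded T) (hψ : IsGraded ψ) (f : B) (a : A) :
    T (star f) * ψ (star (evenPart A a)) + T (star (Grading.γ f)) * ψ (star (oddPart A a))
      - star (T f * ψ a) =
    gradedCommutator (T (star f)) (ψ (star (evenPart A a)))
      + gradedCommutator (T (star (Grading.γ f))) (ψ (star (oddPart A a))) := by
  rw [gradedCommutator_of_even _ (by rw [← hψ, map_star, γ_even]),
    gradedCommutator_of_odd _ (by rw [← hψ, map_star, γ_odd, star_neg, map_neg]), ← hT,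
    map_star Grading.γ, Grading.γ_γ]
  have ha : ψ a = ψ (evenPart A a) + ψ (oddPart A a) := by rw [← map_add, even_add_odd]
  rw [ha]
  simp only [map_star, star_mul, star_add]
  noncomm_ring

end commutators

/-! ### The multiplier algebra -/

section multipliers

variable {B : Type*} [NonUnitalCStarAlgebra B]

lemma coe_injective : Function.Injective (DoubleCentralizer.coe ℂ : B → 𝓜(ℂ, B)) := by
  intro a b h
  rw [← sub_eq_zero, ← CStarRing.mul_star_self_eq_zero_iff]
  have := DFunLike.congr_fun (congrArg (fun T : 𝓜(ℂ, B) => T.fst) h) (star (a - b))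
  simp only [DoubleCentralizer.coe_fst, ContinuousLinearMap.mul_apply'] at this
  rw [sub_mul, this, sub_self]

lemma norm_coe (b : B) : ‖(DoubleCentralizer.coe ℂ b : 𝓜(ℂ, B))‖ = ‖b‖ :=
  NonUnitalStarAlgHom.norm_map (DoubleCentralizer.coeHom : B →⋆ₙₐ[ℂ] 𝓜(ℂ, B)) coe_injective b

lemma norm_coe_sub_coe (a b : B) :
    ‖(DoubleCentralizer.coe ℂ a - DoubleCentralizer.coe ℂ b : 𝓜(ℂ, B))‖ = ‖a - b‖ := by
  rw [← norm_coe (a - b)]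
  exact congrArg norm (map_sub (DoubleCentralizer.coeHom : B →⋆ₙₐ[ℂ] 𝓜(ℂ, B)) a b).symm

/-- `B` is an ideal in `M(B)`. The right linearity of `T.fst` follows from the centralizer relation,
because an element of `B` annihilated by all left multiplications is zero. -/
lemma coe_fst_apply (T : 𝓜(ℂ, B)) (b : B) :
    DoubleCentralizer.coe ℂ (T.fst b) = T * DoubleCentralizer.coe ℂ b := by
  refine UMultiplier.multiplier_ext fun c => ?_
  change T.fst b * c = T.fst (b * c)
  have h : ∀ x : B, x * (T.fst b * c - T.fst (b * c)) = 0 := fun x => by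
    rw [mul_sub, ← T.central, ← mul_assoc, ← T.central, mul_assoc, sub_self]
  rw [← sub_eq_zero, ← CStarRing.star_mul_self_eq_zero_iff]
  exact h _

lemma γ_coe [Grading B] (b : B) :
    Grading.γ (DoubleCentralizer.coe ℂ b : 𝓜(ℂ, B)) = DoubleCentralizer.coe ℂ (Grading.γ b) := by
  refine UMultiplier.multiplier_ext fun c => ?_
  change Grading.γ (b * Grading.γ c) = Grading.γ b * c
  rw [map_mul, Grading.γ_γ]

lemma UMultiplier.norm_scaledFc_fst_le (D : UMultiplier B) (r : ℝ) (f : S) (b : B) :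
    ‖(D.scaledFc r f).fst b‖ ≤ ‖f‖ * ‖b‖ := by
  refine ((D.scaledFc r f).fst.le_opNorm b).trans ?_
  rw [DoubleCentralizer.norm_fst]
  exact mul_le_mul_of_nonneg_right (D.norm_scaledFc_le r f) (norm_nonneg b)

lemma tendsto_zero_of_forall_norm_le {G : Ray → C(unitInterval, B)}
    (h : ∀ ε > 0, ∀ᶠ t in atTop, ∀ s, ‖G t s‖ ≤ ε) : Tendsto G atTop (𝓝 0) := by
  rw [Metric.tendsto_nhds]
  intro ε hε
  filter_upwards [h (ε / 2) (half_pos hε)] with t ht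
  rw [dist_zero_right]
  exact ((ContinuousMap.norm_le _ (half_pos hε).le).2 ht).trans_lt (half_lt_self hε)

end multipliers

/-! ### Reduction to elementary tensors -/

section elementary

open BoundedContinuousFunction

variable {A B C : Type*} [NonUnitalCStarAlgebra A] [Grading A] [NonUnitalCStarAlgebra B] [Grading B]
  [NonUnitalCStarAlgebra C] {F : AlgTensor A B →ₗ[ℂ] (Ray →ᵇ C)}

lemma tendsto_mul_of_tmul (h : ∀ a b c d, Tendsto
    (F (.tmul a b * .tmul c d) - F (.tmul a b) * F (.tmul c d)) atTop (𝓝 0)) (x y : AlgTensor A B) :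
    Tendsto (F (x * y) - F x * F y) atTop (𝓝 0) := by
  induction x using AlgTensor.induction' with
  | h0 => rw [zero_mul, map_zero, zero_mul, sub_zero]; exact tendsto_const_nhds
  | ha x x' hx hx' =>
    have := hx.add hx'
    rw [add_zero] at this
    refine this.congr fun t => ?_
    simp only [add_mul, map_add, coe_sub, coe_add, coe_mul, Pi.sub_apply, Pi.add_apply, Pi.mul_apply]
    abel
  | ht a b =>
  induction y using AlgTensor.induction' with
  | h0 => rw [mul_zero, map_zero, mul_zero, sub_zero]; exact tendsto_const_nhds
  | ha x x' hx hx' =>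
    have := hx.add hx'
    rw [add_zero] at this
    refine this.congr fun t => ?_
    simp only [mul_add, map_add, coe_sub, coe_add, coe_mul, Pi.sub_apply, Pi.add_apply, Pi.mul_apply]
    abel
  | ht c d => exact h a b c d

lemma tendsto_star_of_tmul (h : ∀ a b, Tendsto
    (F (star (.tmul a b)) - star (F (.tmul a b))) atTop (𝓝 0)) (x : AlgTensor A B) :
    Tendsto (F (star x) - star (F x)) atTop (𝓝 0) := by
  induction x using AlgTensor.induction' with
  | h0 => rw [star_zero, map_zero, star_zero, sub_zero]; exact tendsto_const_nhds
  | ha x x' hx hx' =>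
    have := hx.add hx'
    rw [add_zero] at this
    refine this.congr fun t => ?_
    simp only [star_add, map_add, coe_sub, coe_add, Pi.sub_apply, Pi.add_apply]
    abel
  | ht a b => exact h a b

lemma map_γMap_of_tmul [Grading C]
    (h : ∀ a b t, F (AlgTensor.γMap A B (.tmul a b)) t = Grading.γ (F (.tmul a b) t))
    (x : AlgTensor A B) (t : Ray) : F (AlgTensor.γMap A B x) t = Grading.γ (F x t) := by
  induction x using AlgTensor.induction' with
  | h0 => simp
  | ha x y hx hy => simp only [map_add, coe_add, Pi.add_apply, hx, hy]
  | ht a b => exact h a b t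

end elementary

/-! ### The homotopy of an asymptotic pair to zero -/

section homotopy

variable {A B : Type*} [NonUnitalCStarAlgebra A] [Grading A] [NonUnitalCStarAlgebra B]

open BoundedContinuousFunction

namespace UMultiplier

variable (D : UMultiplier B)

/-- The function `t ↦ (s ↦ f(t⁻¹ s D) b)`. -/
def homotopyFun (f : S) (b : B) : Ray →ᵇ C(unitInterval, B) :=
  BoundedContinuousFunction.ofNormedAddCommGroup
    (fun t => ⟨fun s => (D.scaledFc ((t : ℝ)⁻¹ * s) f).fst b,
      (D.continuous_scaledFc_fst f b).comp (by fun_prop)⟩)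
    (by
      have hinv : Continuous fun t : Ray => (t : ℝ)⁻¹ :=
        continuous_subtype_val.inv₀ fun t => (zero_lt_one.trans_le t.2).ne'
      -- Joint continuity in `(t, s)`, including `s = 0`, gives continuity in `t` for the supremum
      -- norm over `s` by currying.
      have h : Continuous fun p : Ray × unitInterval =>
          (D.scaledFc ((p.1 : ℝ)⁻¹ * p.2) f).fst b :=
        (D.continuous_scaledFc_fst f b).comp
          ((hinv.comp continuous_fst).mul (continuous_subtype_val.comp continuous_snd))
      exact (ContinuousMap.curry ⟨_, h⟩).continuous)
    (‖f‖ * ‖b‖)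
    (fun t => (ContinuousMap.norm_le _ (by positivity)).2 fun s => D.norm_scaledFc_fst_le _ f b)

lemma homotopyFun_apply (f : S) (b : B) (t : Ray) (s : unitInterval) :
    D.homotopyFun f b t s = (D.scaledFc ((t : ℝ)⁻¹ * s) f).fst b := rfl

/-- The family `f ⊗ a ↦ f(t⁻¹ s D) φ(a)` on the algebraic tensor product. -/
def homotopyMap (φ : A →⋆ₙₐ[ℂ] B) : AlgTensor S A →ₗ[ℂ] (Ray →ᵇ C(unitInterval, B)) :=
  TensorProduct.lift (LinearMap.mk₂ ℂ (fun f a => D.homotopyFun f (φ a))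
    (fun f g a => by ext t s; simp [homotopyFun_apply])
    (fun c f a => by ext t s; simp [homotopyFun_apply])
    (fun f a b => by ext t s; simp [homotopyFun_apply])
    (fun c f a => by ext t s; simp [homotopyFun_apply]))

lemma homotopyMap_tmul (φ : A →⋆ₙₐ[ℂ] B) (f : S) (a : A) :
    D.homotopyMap φ (.tmul f a) = D.homotopyFun f (φ a) := by
  exact TensorProduct.lift.tmul f a

/-- Moves computations to `M(B)`, where the family is a product of two graded `*`-homomorphisms and
its defects are graded commutators. -/
lemma coe_homotopyMap_tmul (φ : A →⋆ₙₐ[ℂ] B) (f : S) (a : A) (t : Ray) (s : unitInterval) :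
    DoubleCentralizer.coe ℂ (D.homotopyMap φ (.tmul f a) t s) =
      D.scaledFc ((t : ℝ)⁻¹ * s) f * DoubleCentralizer.coeHom.comp φ a := by
  rw [homotopyMap_tmul, homotopyFun_apply, coe_fst_apply]
  rfl

end UMultiplier

variable [Grading B] {φ : A →⋆ₙₐ[ℂ] B} {D : UMultiplier B}

/-- Scalars are even and central. This covers both the endpoint `s = 0` and the pair `(φ, 0)`. -/
lemma gradedCommutator_smul_one (c : ℂ) (T : 𝓜(ℂ, B)) : gradedCommutator (c • 1) T = 0 := by
  rw [gradedCommutator, map_smul, map_one, ← add_mul, even_add_odd, smul_mul_assoc, one_mul,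
    mul_smul_comm, mul_one, sub_self]

/-- The commutators `[f(t⁻¹ s D), φ(a)]` vanish as `t → ∞`, uniformly in `s`. -/
lemma IsAsymptoticPair.eventually_commutator_le {ψ : A →⋆ₙₐ[ℂ] 𝓜(ℂ, B)}
    (h : IsAsymptoticPair ψ D) (f : S) (a : A) {ε : ℝ} (hε : 0 < ε) :
    ∀ᶠ t : Ray in atTop, ∀ s : unitInterval,
      ‖gradedCommutator (D.scaledFc ((t : ℝ)⁻¹ * s) f) (ψ a)‖ ≤ ε := by
  obtain ⟨t₀, ht₀⟩ := eventually_atTop.1 ((Metric.tendsto_nhds.1 (h.commutator f a)) ε hε)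
  filter_upwards [eventually_ge_atTop t₀] with t ht s
  have ht0 : (0 : ℝ) < t := zero_lt_one.trans_le t.2
  by_cases hs : (s : ℝ) = 0
  · rw [hs, mul_zero, UMultiplier.scaledFc_zero, gradedCommutator_smul_one, norm_zero]
    exact hε.le
  · have hs0 : (0 : ℝ) < s := lt_of_le_of_ne s.2.1 (Ne.symm hs)
    -- Since `t⁻¹ s = (t / s)⁻¹` and `t / s ≥ t`, the threshold `t₀` of the original commutator
    -- condition serves all `s` at once.
    have hle : (t : ℝ) ≤ t / s := le_div_self ht0.le hs0 s.2.2
    have h1 := ht₀ ⟨t / s, le_trans t.2 hle⟩ (ht.trans hle)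
    rw [dist_zero_right] at h1
    rw [UMultiplier.scaledFc_eq_fc _ (by positivity)]
    have he : ((t : ℝ) / s)⁻¹ = (t : ℝ)⁻¹ * s := by rw [inv_div, div_eq_inv_mul]
    simp only [he] at h1
    exact h1.le

lemma IsAsymptoticPair.tendsto_homotopyMap_mul
    (h : IsAsymptoticPair (DoubleCentralizer.coeHom.comp φ) D) (f g : S) (a b : A) :
    Tendsto (D.homotopyMap φ (.tmul f a * .tmul g b)
      - D.homotopyMap φ (.tmul f a) * D.homotopyMap φ (.tmul g b)) atTop (𝓝 0) := by
  refine tendsto_zero_of_forall_norm_le fun ε hε => ?_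
  have hf := norm_nonneg f
  have hb := norm_nonneg b
  -- Call this number `δ`. It is chosen so that `(‖f‖ + 1) (δ + δ) (‖b‖ + 1) = ε`, which bounds `T f
  -- * (two commutators) * ψ b`. The odd part of `a` is paired with `γ g` because of the Koszul
  -- sign.
  have hδ : 0 < ε / (2 * (‖f‖ + 1) * (‖b‖ + 1)) := by positivity
  filter_upwards [h.eventually_commutator_le g (evenPart A a) hδ,
    h.eventually_commutator_le (Grading.γ g) (oddPart A a) hδ] with t h1 h2 s
  specialize h1 s
  specialize h2 s
  rw [← norm_coe]
  have key : (DoubleCentralizer.coe ℂ ((D.homotopyMap φ (.tmul f a * .tmul g b)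
      - D.homotopyMap φ (.tmul f a) * D.homotopyMap φ (.tmul g b)) t s) : 𝓜(ℂ, B)) = _ :=
    Eq.trans ?_ (map_tmul_mul_sub (h.odd.isGraded_scaledFc ((t : ℝ)⁻¹ * s)) h.graded f g a b)
  · rw [key]
    refine (norm_mul_le _ _).trans ?_
    have hn : ‖DoubleCentralizer.coeHom.comp φ b‖ ≤ ‖b‖ := NonUnitalStarAlgHom.norm_apply_le _ b
    have hT := D.norm_scaledFc_le ((t : ℝ)⁻¹ * s) f
    calc _ ≤ ((‖f‖ + 1) * (ε / (2 * (‖f‖ + 1) * (‖b‖ + 1)) + ε / (2 * (‖f‖ + 1) * (‖b‖ + 1))))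
            * (‖b‖ + 1) := by
          refine mul_le_mul ((norm_mul_le _ _).trans ?_) (hn.trans (by linarith))
            (norm_nonneg _) (by positivity)
          exact mul_le_mul (hT.trans (by linarith)) ((norm_add_le _ _).trans (add_le_add h1 h2))
            (norm_nonneg _) (by positivity)
      _ = ε := by field_simp; ring
  · rw [AlgTensor.tmul_mul_tmul, map_add, ← UMultiplier.coe_homotopyMap_tmul,
      ← UMultiplier.coe_homotopyMap_tmul,
      ← UMultiplier.coe_homotopyMap_tmul, ← UMultiplier.coe_homotopyMap_tmul]
    simp only [coe_sub, coe_add, coe_mul, Pi.sub_apply, Pi.add_apply, Pi.mul_apply,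
      ContinuousMap.sub_apply, ContinuousMap.add_apply, ContinuousMap.mul_apply]
    exact ((map_sub (DoubleCentralizer.coeHom : B →⋆ₙₐ[ℂ] 𝓜(ℂ, B)) _ _).trans
      (congrArg₂ _ (map_add _ _ _) (map_mul _ _ _)))

lemma IsAsymptoticPair.tendsto_homotopyMap_star
    (h : IsAsymptoticPair (DoubleCentralizer.coeHom.comp φ) D) (f : S) (a : A) :
    Tendsto (D.homotopyMap φ (star (.tmul f a)) - star (D.homotopyMap φ (.tmul f a)))
      atTop (𝓝 0) := by
  refine tendsto_zero_of_forall_norm_le fun ε hε => ?_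
  filter_upwards [h.eventually_commutator_le (star f) (star (evenPart A a)) (half_pos hε),
    h.eventually_commutator_le (star (Grading.γ f)) (star (oddPart A a)) (half_pos hε)]
    with t h1 h2 s
  specialize h1 s
  specialize h2 s
  rw [← norm_coe]
  have key : (DoubleCentralizer.coe ℂ ((D.homotopyMap φ (star (.tmul f a))
      - star (D.homotopyMap φ (.tmul f a))) t s) : 𝓜(ℂ, B)) = _ :=
    Eq.trans ?_ (map_tmul_star_sub (h.odd.isGraded_scaledFc ((t : ℝ)⁻¹ * s)) h.graded f a)
  · rw [key]
    refine (norm_add_le _ _).trans ?_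
    linarith
  · rw [AlgTensor.star_tmul, map_add, ← UMultiplier.coe_homotopyMap_tmul,
      ← UMultiplier.coe_homotopyMap_tmul,
      ← UMultiplier.coe_homotopyMap_tmul]
    simp only [coe_sub, coe_add, coe_star, Pi.sub_apply, Pi.add_apply, Pi.star_apply,
      ContinuousMap.sub_apply, ContinuousMap.add_apply, ContinuousMap.star_apply]
    exact ((map_sub (DoubleCentralizer.coeHom : B →⋆ₙₐ[ℂ] 𝓜(ℂ, B)) _ _).trans
      (congrArg₂ _ (map_add _ _ _) (map_star _ _)))

lemma IsAsymptoticPair.isAsympHom_homotopyMap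
    (h : IsAsymptoticPair (DoubleCentralizer.coeHom.comp φ) D) : IsAsympHom (D.homotopyMap φ) where
  map_mul := tendsto_mul_of_tmul fun f a g b => h.tendsto_homotopyMap_mul f g a b
  map_star := tendsto_star_of_tmul h.tendsto_homotopyMap_star
  norm_le f a := by
    rw [UMultiplier.homotopyMap_tmul]
    refine (norm_ofNormedAddCommGroup_le _ (by positivity) _).trans ?_
    exact mul_le_mul_of_nonneg_left (NonUnitalStarAlgHom.norm_apply_le φ a) (norm_nonneg f)

/-- For odd `D` the functional calculus respects the gradings exactly, at every `t` and `s`, and so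
does `φ`. -/
lemma IsAsymptoticPair.homotopyMap_γMap
    (h : IsAsymptoticPair (DoubleCentralizer.coeHom.comp φ) D) (x : AlgTensor S A) (t : Ray) :
    D.homotopyMap φ (AlgTensor.γMap S A x) t = Grading.γ (D.homotopyMap φ x t) := by
  refine map_γMap_of_tmul (fun f a t => ?_) x t
  ext s
  apply coe_injective
  change _ = (DoubleCentralizer.coe ℂ (Grading.γ (D.homotopyMap φ (.tmul f a) t s)) : 𝓜(ℂ, B))
  rw [← γ_coe, AlgTensor.γMap_tmul, UMultiplier.coe_homotopyMap_tmul,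
    UMultiplier.coe_homotopyMap_tmul, map_mul, h.odd.isGraded_scaledFc, h.graded]

/-- The asymptotic pairs `(φ, s D)`, for `0 ≤ s ≤ 1`, are represented by a homotopy. -/
lemma IsAsymptoticPair.exists_homotopy
    (h : IsAsymptoticPair (DoubleCentralizer.coeHom.comp φ) D) :
    ∃ H : AsymptoticMorphism (GTensor S A) C(unitInterval, B),
      Represents (DoubleCentralizer.coeHom.comp φ) D (H.eval 1) ∧
      Represents (DoubleCentralizer.coeHom.comp φ) 0 (H.eval 0) := by
  obtain ⟨H, hH⟩ := h.isAsympHom_homotopyMap.exists_asymptoticMorphism h.homotopyMap_γMap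
  have hcoe : ∀ (s : unitInterval) (f : S) (a : A), Tendsto (fun t =>
      DoubleCentralizer.coe ℂ ((H.eval s).toFun t (.tmul f a)) -
        D.scaledFc ((t : ℝ)⁻¹ * s) f * DoubleCentralizer.coeHom.comp φ a) atTop (𝓝 0) :=
    fun s f a => by
      -- Evaluation at `s` is contractive and `B → M(B)` is isometric, so the convergence in
      -- `C([0,1], B)` carries over.
      refine squeeze_zero_norm (fun t => ?_) (tendsto_zero_iff_norm_tendsto_zero.1 (hH (.tmul f a)))
      rw [← UMultiplier.coe_homotopyMap_tmul]
      exact (norm_coe_sub_coe _ _).trans_le (ContinuousMap.norm_coe_le_norm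
        (H.toFun t (.tmul f a) - D.homotopyMap φ (.tmul f a) t) s)
  -- At `s = 1` the family is `f(t⁻¹ D) φ(a)`. At `s = 0` it is `f(0) φ(a)`, which is also the
  -- functional calculus of the zero multiplier applied to any rescaling of `f`.
  refine ⟨H, fun f a => (hcoe 1 f a).congr fun t => ?_, fun f a => (hcoe 0 f a).congr fun t => ?_⟩
  · have ht : (t : ℝ) ≠ 0 := (zero_lt_one.trans_le t.2).ne'
    rw [UMultiplier.scaledFc_eq_fc _ (by simpa using ht)]
    simp
  · rw [UMultiplier.zero_fc, Set.Icc.coe_zero, mul_zero, UMultiplier.scaledFc_zero]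

/-- If `φ` takes values in `B`, then `(φ, 0)` is an asymptotic pair. -/
lemma IsAsymptoticPair.zero (h : IsAsymptoticPair (DoubleCentralizer.coeHom.comp φ) D) :
    IsAsymptoticPair (DoubleCentralizer.coeHom.comp φ) (0 : UMultiplier B) where
  graded := h.graded
  strict := h.strict
  odd x := ⟨trivial, by
    change (0 : B) = -Grading.γ 0
    rw [map_zero, neg_zero]⟩
  -- `f(0) φ(a)` lies in `B` only because `φ(a)` does: for `φ` with values in `M(B)`, the pair `(φ,
  -- 0)` may fail this condition.
  mem f a := ⟨f 0 • φ a, by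
    rw [UMultiplier.zero_fc, smul_mul_assoc, one_mul]
    exact (map_smul (DoubleCentralizer.coeHom : B →⋆ₙₐ[ℂ] 𝓜(ℂ, B)) _ _).symm⟩
  commutator f a := by
    simp only [UMultiplier.zero_fc, gradedCommutator_smul_one]
    exact tendsto_const_nhds

/-- Two asymptotic morphisms which represent the same pair are asymptotically equivalent. -/
lemma Represents.asympEquiv {ψ : A →⋆ₙₐ[ℂ] 𝓜(ℂ, B)} {Φ Ψ : AsymptoticMorphism (GTensor S A) B}
    (hΦ : Represents ψ D Φ) (hΨ : Represents ψ D Ψ) : Φ.AsympEquiv Ψ := by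
  refine .of_tmul fun f a => ?_
  rw [tendsto_zero_iff_norm_tendsto_zero]
  have := (hΦ f a).sub (hΨ f a)
  rw [sub_zero, tendsto_zero_iff_norm_tendsto_zero] at this
  refine this.congr fun t => ?_
  rw [sub_sub_sub_cancel_right, norm_coe_sub_coe]

/-- Representatives of a pair are asymptotically equivalent, hence homotopic, so a single
representative determines the class. -/
lemma Represents.isClassOf_iff {θ : B ≃⋆ₐ[ℂ] GTensor B K} {hθ : IsGraded θ}
    {ψ : A →⋆ₙₐ[ℂ] 𝓜(ℂ, B)} {Φ : AsymptoticMorphism (GTensor S A) B} (hΦ : Represents ψ D Φ)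
    (y : ETheory A B) : IsClassOf θ hθ ψ D y ↔ y = Quot.mk _ (Φ.map θ hθ) := by
  refine ⟨?_, fun hy => ⟨Φ, hΦ, hy⟩⟩
  rintro ⟨Ψ, hΨ, rfl⟩
  exact Quot.sound ((hΨ.asympEquiv hΦ).map θ hθ).homotopic

end homotopy

end ETh

end

/-! ### Equality of the classes of `(φ, D)` and `(φ, 0)` -/

open ETh

theorem mainTheorem9 {A : Type*} {B : Type*}
    [NonUnitalCStarAlgebra A] [Grading A] [TopologicalSpace.SeparableSpace A]
    [NonUnitalCStarAlgebra B] [Grading B] [TopologicalSpace.SeparableSpace B]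
    (θ : B ≃⋆ₐ[ℂ] GTensor B K) (hθ : IsGraded θ)
    (φ : A →⋆ₙₐ[ℂ] B) (D : UMultiplier B)
    (h : IsAsymptoticPair (DoubleCentralizer.coeHom.comp φ) D) :
    IsAsymptoticPair (DoubleCentralizer.coeHom.comp φ) (0 : UMultiplier B) ∧
    ∃ x : EPrime A θ hθ,
      (∀ y : ETheory A B, IsClassOf θ hθ (DoubleCentralizer.coeHom.comp φ) D y ↔ y = x) ∧
      (∀ y : ETheory A B, IsClassOf θ hθ (DoubleCentralizer.coeHom.comp φ) 0 y ↔ y = x) := by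
  obtain ⟨H, h1, h0⟩ := h.exists_homotopy
  -- `H` is by construction a homotopy between its own evaluations, so the endpoint conditions hold
  -- on the nose.
  have hH : AsymptoticMorphism.Homotopic (H.eval 0) (H.eval 1) := ⟨H, fun t a => ⟨rfl, rfl⟩⟩
  have hq : Quot.mk _ ((H.eval 0).map θ hθ) = Quot.mk _ ((H.eval 1).map θ hθ) :=
    Quot.sound (hH.map θ hθ)
  refine ⟨h.zero, ⟨Quot.mk _ ((H.eval 1).map θ hθ), _, D, h, _, h1, rfl⟩, h1.isClassOf_iff,
    fun y => ?_⟩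
  rw [h0.isClassOf_iff, hq]
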